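/- Let $F$ be an algebraically closed field of characteristic zero and $G$ a finite group. Let $\Omega$ be the free associative $G$-graded $F$-algebra (without constant terms) on variables $x_{i,g}$ ($i\in\mathbb N$, $g\in G$), where $x_{i,g}$ has degree $g$; its elements are called graded polynomials. A graded polynomial is \emph{multilinear} if, for some finite set $V$ of variables, each of its monomials contains every variable of $V$ exactly once and no other variable; it is \emph{strongly homogeneous} if all its monomials have the same $G$-degree. A \emph{$T$-ideal} is a two-sided ideal of $\Omega$ (an $F$-subspace) closed under all $G$-graded endomorphisms of $\Omega$. A multilinear polynomial $p$ is \emph{alternating} in a set $S=\{x_{1,g},\dots,x_{m,g}\}$ of its variables of degree $g$ if $p=\sum_{\sigma\in \mathrm{Sym}(m)}\mathrm{sgn}(\sigma)\,h(x_{\sigma(1),g},\dots,x_{\sigma(m),g};Y)$ for some polynomial $h$ multilinear in the same variables, where $Y$ denotes the variables of $p$ outside $S$. Let $A=\bigoplus_{g\in G}A_g$ be a finite-dimensional associative $G$-graded $F$-algebra, not necessarily with identity, with Jacobson radical $J(A)$. Let $\mathrm{id}_G(A)\subseteq\Omega$ be its $T$-ideal of graded identities, i.e. of those graded polynomials that vanish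 under all admissible evaluations (each $x_{i,g}$ is sent into $A_g$). Write $A=\overline A\oplus J(A)$, where $\overline A=A_1\times\cdots\times A_q$ is a semisimple graded subalgebra and the $A_i$ are $G$-simple, and put $d_g=\dim_F\overline A_g=\dim_F (A/J(A))_g$ for $g\in G$. The algebra $A$ is \emph{full with respect to} a multilinear graded polynomial $f$ if there is an admissible evaluation with $f\neq0$ in which each variable of $f$ takes a value in $J(A)$ or in one of the $A_i$, and every $A_i$ contains the value of at least one variable of $f$; $A$ is \emph{full} if it is full with respect to some $f$. Assume that $A$ is \emph{subdirectly irreducible}: it has no two nonzero $G$-graded two-sided ideals with zero intersection. (1) If $A$ is full with respect to the multilinear graded polynomial $f$, then for every integer $\nu\ge0$ the $T$-ideal generated by $f$ contains a multilinear polynomial $f'\notin \mathrm{id}_G(A)$ which, for every $g\in G$, is alternating in each of $\nu$ sets of $d_g$ variables of degree $g$, all these sets being pairwise disjoint. If $f$ is strongly homogeneous, then $f'$ can be chosen strongly homogeneous. (2) Let $\mathrm{Ind}(A)_0$ be the set of all $\alpha=(\alpha_g)_{g\in G}\in\mathbb Z_{\ge0}^{G}$ such that for every integer $\nu\ge0$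 there is a multilinear strongly homogeneous graded polynomial outside $\mathrm{id}_G(A)$ which, for every $g\in G$, is alternating in each of $\nu$ sets of $\alpha_g$ variables of degree $g$, all these sets being pairwise disjoint. Let $E_0(A)$ be the set of extremal points of $\mathrm{Ind}(A)_0$, i.e. its maximal elements for the componentwise order. If $A$ is full, then $E_0(A)=\{(d_g)_{g\in G}\}$. -/

import Mathlib

/-! Graded polynomials: a pair `(g, i)` is the `i`-th variable `x_{i,g}` of degree `g`. -/

namespace GradedPI

/-- The free `G`-graded associative algebra over `F` on the variables `x_{i,g}`. It has no
constant term, so that its elements can be evaluated on algebras without identity. -/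
abbrev GPoly (F G : Type*) [Field F] : Type _ := MonoidAlgebra F (FreeSemigroup (G × ℕ))

section Polynomials

variable {F G : Type*} [Field F]

/-- The variable `x`, as a graded polynomial. -/
noncomputable def gvar (x : G × ℕ) : GPoly F G :=
  MonoidAlgebra.single (FreeSemigroup.of x) 1

/-- The evaluation of graded polynomials on an algebra `A` (not necessarily with identity)
which sends the variable `x` to `φ x`. -/
noncomputable def evalAt {A : Type*} [NonUnitalRing A] [Module F A] [IsScalarTower F A A]
    [SMulCommClass F A A] (φ : G × ℕ → A) : GPoly F G →ₙₐ[F] A :=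
  MonoidAlgebra.liftMagma F (FreeSemigroup.lift φ)

/-- The list of the variables of a monomial, in order. -/
def letters (w : FreeSemigroup (G × ℕ)) : List (G × ℕ) := w.head :: w.tail

/-- The `G`-degree of a monomial: the product of the degrees of its variables, in order. -/
def wordDegree [Group G] : FreeSemigroup (G × ℕ) →ₙ* G := FreeSemigroup.lift Prod.fst

/-- `p` is a linear combination of monomials of `G`-degree `g`. -/
def HasDegree [Group G] (p : GPoly F G) (g : G) : Prop :=
  ∀ w ∈ p.coeff.support, wordDegree w = g

/-- All the monomials of `p` have the same `G`-degree. -/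
def IsStronglyHomogeneous [Group G] (p : GPoly F G) : Prop := ∃ g, HasDegree p g

/-- `p` is multilinear in the set of variables `V`: every monomial of `p` contains each
variable of `V` exactly once, and no other variable. -/
def IsMultilinearIn (V : Finset (G × ℕ)) (p : GPoly F G) : Prop :=
  ∀ w ∈ p.coeff.support, (letters w).Nodup ∧ ∀ x, x ∈ letters w ↔ x ∈ V

/-- `p` is multilinear. -/
def IsMultilinear (p : GPoly F G) : Prop := ∃ V : Finset (G × ℕ), IsMultilinearIn V p

open Classical in
/-- The polynomial `p`, multilinear in `V`, is alternating in the set of variables `S ⊆ V`: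
it is obtained by alternating the variables of `S` in some polynomial `h` that is multilinear
in `V`. -/
def AlternatesIn (V S : Finset (G × ℕ)) (p : GPoly F G) : Prop :=
  ∃ h : GPoly F G, IsMultilinearIn V h ∧
    p = ∑ σ : Equiv.Perm S, ((Equiv.Perm.sign σ : ℤˣ) : ℤ) •
      evalAt (fun x => (gvar (Equiv.Perm.ofSubtype σ x) : GPoly F G)) h

/-- `p` is multilinear and, for every `g`, has `ν` alternating sets of `d g` variables of
degree `g`; all these sets are pairwise disjoint. -/
def IsFoldAlternating (ν : ℕ) (d : G → ℕ) (p : GPoly F G) : Prop :=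
  ∃ (V : Finset (G × ℕ)) (S : G → Fin ν → Finset (G × ℕ)),
    IsMultilinearIn V p ∧
    (∀ g j, S g j ⊆ V ∧ (∀ x ∈ S g j, x.1 = g) ∧ (S g j).card = d g) ∧
    (∀ g j j', j ≠ j' → Disjoint (S g j) (S g j')) ∧
    ∀ g j, AlternatesIn V (S g j) p

/-- `Γ` is a `T`-ideal: a two-sided ideal closed under all `G`-graded endomorphisms. -/
structure IsTIdeal [Group G] (Γ : Submodule F (GPoly F G)) : Prop where
  mul_left : ∀ p q : GPoly F G, q ∈ Γ → p * q ∈ Γ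
  mul_right : ∀ p q : GPoly F G, q ∈ Γ → q * p ∈ Γ
  endo : ∀ θ : GPoly F G →ₙₐ[F] GPoly F G, (∀ g p, HasDegree p g → HasDegree (θ p) g) →
    ∀ q ∈ Γ, θ q ∈ Γ

/-- The `T`-ideal generated by `f`. -/
noncomputable def tIdealSpan [Group G] (f : GPoly F G) : Submodule F (GPoly F G) :=
  sInf {Γ | IsTIdeal Γ ∧ f ∈ Γ}

/-- The points `α` such that for every `ν` there is a multilinear (strongly homogeneous)
graded polynomial outside `Γ` with `ν` alternating `g`-sets of cardinality `α g`, every `g`. -/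
def Ind₀ [Group G] (Γ : Submodule F (GPoly F G)) : Set (G → ℕ) :=
  {α | ∀ ν : ℕ, ∃ p : GPoly F G, p ∉ Γ ∧ IsStronglyHomogeneous p ∧ IsFoldAlternating ν α p}

/-- The extremal points of `Ind₀ Γ`. -/
def E₀ [Group G] (Γ : Submodule F (GPoly F G)) : Set (G → ℕ) :=
  {α | α ∈ Ind₀ Γ ∧ ∀ β ∈ Ind₀ Γ, α ≤ β → β = α}

end Polynomials

section Algebras

variable {F G A : Type*} [Field F] [NonUnitalRing A] [Module F A]

/-- The subspaces `𝒜 g` form a `G`-grading of the algebra `A`. -/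
structure IsGrading [Group G] (𝒜 : G → Submodule F A) : Prop where
  mul_mem : ∀ g h, ∀ a ∈ 𝒜 g, ∀ b ∈ 𝒜 h, a * b ∈ 𝒜 (g * h)
  indep : iSupIndep 𝒜
  iSup_eq_top : ⨆ g, 𝒜 g = ⊤

/-- The subspace `U` is graded, i.e. spanned by homogeneous elements. -/
def IsGradedSubspace (𝒜 : G → Submodule F A) (U : Submodule F A) : Prop :=
  U = ⨆ g, U ⊓ 𝒜 g

/-- `I ⊆ B` is a two-sided graded ideal of the graded subalgebra `B`. -/
structure IsGradedIdealOf (𝒜 : G → Submodule F A) (B I : Submodule F A) : Prop where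
  le : I ≤ B
  graded : IsGradedSubspace 𝒜 I
  mul_left : ∀ b ∈ B, ∀ a ∈ I, b * a ∈ I
  mul_right : ∀ b ∈ B, ∀ a ∈ I, a * b ∈ I

/-- No two nonzero graded ideals of `A` intersect in zero. -/
def IsSubdirectlyIrreducible (𝒜 : G → Submodule F A) : Prop :=
  ∀ I J : Submodule F A, IsGradedIdealOf 𝒜 ⊤ I → IsGradedIdealOf 𝒜 ⊤ J → I ⊓ J = ⊥ →
    I = ⊥ ∨ J = ⊥

/-- `B` is a `G`-simple graded subalgebra: its multiplication is not zero and it has no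
graded ideals other than `0` and `B`. -/
structure IsGSimple (𝒜 : G → Submodule F A) (B : Submodule F A) : Prop where
  graded : IsGradedSubspace 𝒜 B
  mul_mem : ∀ a ∈ B, ∀ b ∈ B, a * b ∈ B
  mul_ne_zero : ∃ a ∈ B, ∃ b ∈ B, a * b ≠ 0
  eq_bot_or_eq : ∀ I, IsGradedIdealOf 𝒜 B I → I = ⊥ ∨ I = B

variable [IsScalarTower F A A] [SMulCommClass F A A]

/-- The Jacobson radical `J(A)` of an algebra `A` that need not have an identity:
`J(A) = A ∩ J(A¹)`, where `A¹` is `A` with an identity adjoined. -/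
noncomputable def radical (F A : Type*) [Field F] [NonUnitalRing A] [Module F A]
    [IsScalarTower F A A] [SMulCommClass F A A] : Submodule F A :=
  ((Ring.jacobson (Unitization F A)).restrictScalars F).comap (Unitization.inrHom F F A)

/-- The dimension of the `g`-component of the semisimple algebra `A / J(A)`. -/
noncomputable def semisimpleDim (𝒜 : G → Submodule F A) (g : G) : ℕ :=
  Module.finrank F ((𝒜 g).map (radical F A).mkQ)

/-- A graded Wedderburn-Malcev decomposition `A = A₁ ⊕ ⋯ ⊕ A_q ⊕ J(A)`: the `A_i` are
`G`-simple and annihilate one another, so that `A₁ × ⋯ × A_q` is a semisimple graded subalgebra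
of `A`, which is a complement of `J(A)`. -/
structure WedderburnMalcev (𝒜 : G → Submodule F A) where
  q : ℕ
  comp : Fin q → Submodule F A
  simple : ∀ i, IsGSimple 𝒜 (comp i)
  orthogonal : ∀ i j, i ≠ j → ∀ a ∈ comp i, ∀ b ∈ comp j, a * b = 0
  indep : iSupIndep comp
  isCompl : IsCompl (⨆ i, comp i) (radical F A)

/-- An admissible evaluation: variables of degree `g` take values in `𝒜 g`. -/
def IsAdmissible (𝒜 : G → Submodule F A) (φ : G × ℕ → A) : Prop := ∀ x, φ x ∈ 𝒜 x.1

/-- The graded identities of `A`. -/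
noncomputable def gradedIdentities (𝒜 : G → Submodule F A) : Submodule F (GPoly F G) where
  carrier := {p | ∀ φ : G × ℕ → A, IsAdmissible 𝒜 φ → evalAt φ p = 0}
  add_mem' := fun hp hq φ hφ => by rw [map_add, hp φ hφ, hq φ hφ, add_zero]
  zero_mem' := fun φ _ => map_zero _
  smul_mem' := fun c p hp φ hφ => by rw [map_smul, hp φ hφ, smul_zero]

/-- `A` is full with respect to the multilinear graded polynomial `f`: some nonvanishing
admissible evaluation sends every variable of `f` to the radical or to a `G`-simple component,
every `G`-simple component being the target of some variable. -/
def IsFullWith (𝒜 : G → Submodule F A) (f : GPoly F G) : Prop :=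
  ∃ (W : WedderburnMalcev 𝒜) (V : Finset (G × ℕ)) (φ : G × ℕ → A),
    IsMultilinearIn V f ∧ IsAdmissible 𝒜 φ ∧ evalAt φ f ≠ 0 ∧
    (∀ x ∈ V, φ x ∈ radical F A ∨ ∃ i, φ x ∈ W.comp i) ∧
    ∀ i, ∃ x ∈ V, φ x ∈ W.comp i

/-- `A` is full if it is full with respect to some multilinear graded polynomial. -/
def IsFull (𝒜 : G → Submodule F A) : Prop := ∃ f : GPoly F G, IsFullWith 𝒜 f

end Algebras

end GradedPI

/-! For part (1), take a nonzero evaluation of `f` in which every `A_i` contains the value of some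
variable, called a slot. Bases of the components `Ā_g`, made of elements of the `A_i`, are fed into
the polynomial one element at a time. To add `b ∈ A_i` to an alternating set, replace the slot of
`A_i` by a product `y z w` of fresh variables and alternate `z` with the set; `z` takes the value
`b`, while `y` and `w` take homogeneous values `r`, `s` in `A_i`.

The value obtained is linear in the operator `r · s`. The density theorem
`IsGSimple.exists_sandwich` gives a combination of such operators which sends `b` to the old slot
value and kills the other values of the set. On that combination the new value equals the old
nonzero one, so a single pair `r`, `s` already gives a nonzero value. The variable `y` is the new
slot, so the step (`IsStage.insert`) can be repeated indefinitely. Every substitution used is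
graded, which keeps the polynomial in the `T`-ideal and preserves its degree.

That a basis of `Ā_g` has `semisimpleDim 𝒜 g` elements requires the radical to be graded. In
characteristic zero it is the kernel of the trace form, and the grading is read off from that.

For part (2), fullness passes to a homogeneous component of `f`, so part (1) puts `(d_g)` into
`Ind₀`. Conversely (`le_semisimpleDim_of_mem_Ind₀`), the values of an alternating set of more than
`d_g` variables are dependent modulo the radical, so one of them may be replaced by a radical
element. With as many such sets as the nilpotency index of the radical, the value vanishes. Hence
`(d_g)` is the greatest element of `Ind₀`. -/

namespace GradedPI

open Function
open scoped Classical

/-! ### Words and their letters -/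

section Words

variable {F G : Type*} [Field F]

/-- The graded polynomials all of whose monomials belong to `P`. -/
def polysOn (F : Type*) {G : Type*} [Field F] (P : Set (FreeSemigroup (G × ℕ))) :
    Submodule F (GPoly F G) where
  carrier := {p | ∀ w ∈ p.coeff.support, w ∈ P}
  add_mem' := by
    intro p q hp hq w hw
    rcases Finset.mem_union.1 (Finsupp.support_add hw) with h | h
    exacts [hp w h, hq w h]
  zero_mem' := by simp
  smul_mem' := fun c p hp w hw => hp w (Finsupp.support_smul hw)

theorem single_mem_polysOn {P : Set (FreeSemigroup (G × ℕ))} {w : FreeSemigroup (G × ℕ)}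
    (hw : w ∈ P) (c : F) : (MonoidAlgebra.single w c : GPoly F G) ∈ polysOn F P := by
  intro v hv
  have := Finsupp.support_single_subset hv
  rw [Finset.mem_singleton.1 this]
  exact hw

/-- The words in which every variable of `V` occurs exactly once, and no other one occurs. -/
def multilinearWords (V : Finset (G × ℕ)) : Set (FreeSemigroup (G × ℕ)) :=
  {w | (letters w).Nodup ∧ ∀ x, x ∈ letters w ↔ x ∈ V}

theorem letters_of (x : G × ℕ) : letters (FreeSemigroup.of x) = [x] := rfl

theorem letters_mul (u v : FreeSemigroup (G × ℕ)) :
    letters (u * v) = letters u ++ letters v := rfl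

theorem letters_lift (θ : G × ℕ → FreeSemigroup (G × ℕ)) (w : FreeSemigroup (G × ℕ)) :
    letters (FreeSemigroup.lift θ w) = (letters w).flatMap fun x => letters (θ x) := by
  induction w using FreeSemigroup.recOnMul with
  | ih1 x => simp [letters_of]
  | ih2 x w _ ih => simp [letters_mul, letters_of, ih]

theorem lift_congr {S : Type*} [Semigroup S] {φ ψ : G × ℕ → S} {w : FreeSemigroup (G × ℕ)}
    (h : ∀ x ∈ letters w, φ x = ψ x) : FreeSemigroup.lift φ w = FreeSemigroup.lift ψ w := by
  induction w using FreeSemigroup.recOnMul with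
  | ih1 x => simpa [letters_of] using h
  | ih2 x w _ ih =>
    rw [map_mul, map_mul, ih fun y hy => h y (by simp [letters_mul, hy]),
      FreeSemigroup.lift_of, FreeSemigroup.lift_of, h x (by simp [letters_mul, letters_of])]

end Words

/-! ### Evaluations and multilinearity -/

section Evaluation

variable {F G A : Type*} [Field F] [NonUnitalRing A] [Module F A] [IsScalarTower F A A]
  [SMulCommClass F A A]

theorem evalAt_single (φ : G × ℕ → A) (w : FreeSemigroup (G × ℕ)) (c : F) :
    evalAt φ (MonoidAlgebra.single w c : GPoly F G) = c • FreeSemigroup.lift φ w := by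
  simp [evalAt, MonoidAlgebra.liftMagma_apply_apply]

theorem evalAt_eq_sum (φ : G × ℕ → A) (p : GPoly F G) :
    evalAt φ p = p.coeff.sum fun w c => c • FreeSemigroup.lift φ w := by
  conv_lhs => rw [← MonoidAlgebra.sum_coeff_single p]
  rw [Finsupp.sum, map_sum]
  exact Finset.sum_congr rfl fun w _ => evalAt_single φ w _

theorem evalAt_congr {V : Finset (G × ℕ)} {p : GPoly F G} (hp : IsMultilinearIn V p)
    {φ ψ : G × ℕ → A} (h : ∀ x ∈ V, φ x = ψ x) : evalAt φ p = evalAt ψ p := by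
  rw [evalAt_eq_sum, evalAt_eq_sum]
  exact Finset.sum_congr rfl fun w hw =>
    congrArg _ (lift_congr fun x hx => h x (((hp w hw).2 x).1 hx))

/-- Since `x` occurs only once, the word is `u x v` with fixed values for `u` and `v`, and the map
is a composite of multiplications. -/
theorem exists_linear_lift (φ : G × ℕ → A) (x : G × ℕ)
    (w : FreeSemigroup (G × ℕ)) (hn : (letters w).Nodup) (hx : x ∈ letters w) :
    ∃ Λ : A →ₗ[F] A, ∀ a, Λ a = FreeSemigroup.lift (update φ x a) w := by
  induction w using FreeSemigroup.recOnMul with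
  | ih1 y =>
    obtain rfl : x = y := by simpa [letters_of] using hx
    exact ⟨LinearMap.id, by simp⟩
  | ih2 y w _ ih =>
    simp only [letters_mul, letters_of, List.singleton_append, List.nodup_cons,
      List.mem_cons] at hn hx
    by_cases hxy : x = y
    · subst hxy
      refine ⟨LinearMap.mulRight F (FreeSemigroup.lift φ w), fun a => ?_⟩
      rw [map_mul, FreeSemigroup.lift_of, update_self, LinearMap.mulRight_apply]
      congr 1
      exact lift_congr fun z hz => (update_of_ne (ne_of_mem_of_not_mem hz hn.1) _ _).symm
    · obtain ⟨Λ, hΛ⟩ := ih hn.2 (hx.resolve_left hxy)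
      refine ⟨LinearMap.mulLeft F (φ y) ∘ₗ Λ, fun a => ?_⟩
      rw [map_mul, FreeSemigroup.lift_of, update_of_ne (Ne.symm hxy), ← hΛ]
      rfl

/-- A multilinear polynomial is linear in each of its variables. -/
theorem exists_linear_evalAt {V : Finset (G × ℕ)} {p : GPoly F G}
    (hp : IsMultilinearIn V p) (φ : G × ℕ → A) {x : G × ℕ} (hx : x ∈ V) :
    ∃ Λ : A →ₗ[F] A, ∀ a, Λ a = evalAt (update φ x a) p := by
  have h : ∀ w : p.coeff.support, ∃ Λ : A →ₗ[F] A, ∀ a, Λ a =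
      FreeSemigroup.lift (update φ x a) w.1 := fun w =>
    exists_linear_lift φ x w.1 (hp w.1 w.2).1 (((hp w.1 w.2).2 x).2 hx)
  choose Λ hΛ using h
  refine ⟨∑ w ∈ p.coeff.support.attach, p.coeff w.1 • Λ w, fun a => ?_⟩
  rw [evalAt_eq_sum, Finsupp.sum, ← Finset.sum_attach p.coeff.support, LinearMap.sum_apply]
  exact Finset.sum_congr rfl fun w _ => by rw [LinearMap.smul_apply, hΛ]

theorem evalAt_eq_zero_of_apply_eq_zero {V : Finset (G × ℕ)} {p : GPoly F G}
    (hp : IsMultilinearIn V p) {φ : G × ℕ → A} {x : G × ℕ} (hx : x ∈ V) (h : φ x = 0) :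
    evalAt φ p = 0 := by
  obtain ⟨Λ, hΛ⟩ := exists_linear_evalAt hp φ hx
  rw [← update_eq_self x φ, ← hΛ, h, map_zero]

end Evaluation

/-! ### Monomial substitutions and the `T`-ideal -/

section Substitution

variable {F G : Type*} [Field F]

/-- The substitution of the monomials `θ x` for the variables `x`. -/
noncomputable def subst (θ : G × ℕ → FreeSemigroup (G × ℕ)) : GPoly F G →ₙₐ[F] GPoly F G :=
  evalAt fun x => MonoidAlgebra.single (θ x) 1

theorem lift_single (θ : G × ℕ → FreeSemigroup (G × ℕ)) (w : FreeSemigroup (G × ℕ)) :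
    FreeSemigroup.lift (fun x => (MonoidAlgebra.single (θ x) 1 : GPoly F G)) w =
      MonoidAlgebra.single (FreeSemigroup.lift θ w) 1 := by
  induction w using FreeSemigroup.recOnMul with
  | ih1 x => simp
  | ih2 x w _ ih => rw [map_mul, map_mul, ih]; simp [MonoidAlgebra.single_mul_single]

theorem subst_single (θ : G × ℕ → FreeSemigroup (G × ℕ)) (w : FreeSemigroup (G × ℕ)) (c : F) :
    subst θ (MonoidAlgebra.single w c : GPoly F G) =
      MonoidAlgebra.single (FreeSemigroup.lift θ w) c := by
  rw [subst, evalAt_single, lift_single, MonoidAlgebra.smul_single, smul_eq_mul, mul_one]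

theorem evalAt_subst {A : Type*} [NonUnitalRing A] [Module F A] [IsScalarTower F A A]
    [SMulCommClass F A A] (φ : G × ℕ → A) (θ : G × ℕ → FreeSemigroup (G × ℕ)) (p : GPoly F G) :
    evalAt φ (subst θ p) = evalAt (fun x => FreeSemigroup.lift φ (θ x)) p := by
  induction p using MonoidAlgebra.induction_linear with
  | zero => simp
  | add p q hp hq => rw [map_add, map_add, map_add, hp, hq]
  | single w c =>
    rw [subst_single, evalAt_single, evalAt_single]
    congr 1
    induction w using FreeSemigroup.recOnMul with
    | ih1 x => simp
    | ih2 x w _ ih => simp only [map_mul, ih, FreeSemigroup.lift_of]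

theorem subst_subst (θ θ' : G × ℕ → FreeSemigroup (G × ℕ)) (p : GPoly F G) :
    subst θ' (subst θ p) = subst (fun x => FreeSemigroup.lift θ' (θ x)) p := by
  rw [subst, evalAt_subst, subst]
  simp only [lift_single]

theorem subst_congr {V : Finset (G × ℕ)} {p : GPoly F G} (hp : IsMultilinearIn V p)
    {θ θ' : G × ℕ → FreeSemigroup (G × ℕ)} (h : ∀ x ∈ V, θ x = θ' x) :
    subst θ p = subst θ' p :=
  evalAt_congr hp fun x hx => by rw [h x hx]

theorem subst_mem_polysOn {P Q : Set (FreeSemigroup (G × ℕ))}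
    {θ : G × ℕ → FreeSemigroup (G × ℕ)} (h : ∀ w ∈ P, FreeSemigroup.lift θ w ∈ Q)
    {p : GPoly F G} (hp : p ∈ polysOn F P) : subst θ p ∈ polysOn F Q := by
  rw [← MonoidAlgebra.sum_coeff_single p, Finsupp.sum, map_sum]
  refine Submodule.sum_mem _ fun w hw => ?_
  rw [subst_single]
  exact single_mem_polysOn (h w (hp w hw)) _

theorem IsMultilinearIn.subst {V : Finset (G × ℕ)} {p : GPoly F G}
    (hp : IsMultilinearIn V p) {θ : G × ℕ → FreeSemigroup (G × ℕ)}
    (hn : ∀ x ∈ V, (letters (θ x)).Nodup)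
    (hd : ∀ x ∈ V, ∀ y ∈ V, x ≠ y → (letters (θ x)).Disjoint (letters (θ y))) :
    IsMultilinearIn (V.biUnion fun x => (letters (θ x)).toFinset) (subst θ p) := by
  refine subst_mem_polysOn (fun w hw => ?_) hp
  refine ⟨?_, fun x => ?_⟩
  · rw [letters_lift, List.nodup_flatMap]
    refine ⟨fun x hx => hn x ((hw.2 x).1 hx), hw.1.imp_of_mem fun ha hb hab => ?_⟩
    exact hd _ ((hw.2 _).1 ha) _ ((hw.2 _).1 hb) hab
  · rw [letters_lift, List.mem_flatMap]
    simp [hw.2]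

variable [Group G]

theorem HasDegree.subst {p : GPoly F G} {g : G} (hp : HasDegree p g)
    {θ : G × ℕ → FreeSemigroup (G × ℕ)} (hθ : ∀ x, wordDegree (θ x) = x.1) :
    HasDegree (subst θ p) g := by
  refine subst_mem_polysOn (fun w hw => ?_) hp
  refine Eq.trans ?_ (show wordDegree w = g from hw)
  clear hw hp
  induction w using FreeSemigroup.recOnMul with
  | ih1 x => simpa [wordDegree] using hθ x
  | ih2 x w _ ih =>
    rw [map_mul, map_mul, ih, FreeSemigroup.lift_of, hθ x, map_mul]
    rfl

theorem mem_tIdealSpan_self (f : GPoly F G) : f ∈ tIdealSpan f :=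
  Submodule.mem_sInf.2 fun _ h => h.2

theorem subst_mem_tIdealSpan {f q : GPoly F G} (hq : q ∈ tIdealSpan f)
    {θ : G × ℕ → FreeSemigroup (G × ℕ)} (hθ : ∀ x, wordDegree (θ x) = x.1) :
    subst θ q ∈ tIdealSpan f :=
  Submodule.mem_sInf.2 fun Γ h => h.1.endo (subst θ) (fun _ _ hp => hp.subst hθ) q
    (Submodule.mem_sInf.1 hq Γ h)

end Substitution

/-! ### Permuting variables and skew symmetry -/

section Permutations

variable {F G : Type*} [Field F]

/-- The substitution which permutes the variables. -/
noncomputable abbrev permute (σ : Equiv.Perm (G × ℕ)) : GPoly F G →ₙₐ[F] GPoly F G :=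
  subst fun x => FreeSemigroup.of (σ x)

theorem permute_permute (σ τ : Equiv.Perm (G × ℕ)) (p : GPoly F G) :
    permute σ (permute τ p) = permute (σ * τ) p := by
  rw [subst_subst]
  simp only [FreeSemigroup.lift_of]
  rfl

theorem permute_one (p : GPoly F G) : permute 1 p = p := by
  conv_rhs => rw [← MonoidAlgebra.sum_coeff_single p]
  conv_lhs => rw [← MonoidAlgebra.sum_coeff_single p]
  rw [Finsupp.sum, map_sum]
  refine Finset.sum_congr rfl fun w _ => ?_
  rw [subst_single]
  congr 1
  exact congrArg (fun f => f w) (FreeSemigroup.lift_comp_of' (MulHom.id _))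

theorem evalAt_permute {A : Type*} [NonUnitalRing A] [Module F A] [IsScalarTower F A A]
    [SMulCommClass F A A] (φ : G × ℕ → A) (σ : Equiv.Perm (G × ℕ)) (p : GPoly F G) :
    evalAt φ (permute σ p) = evalAt (fun x => φ (σ x)) p := by
  rw [evalAt_subst]
  simp

theorem IsMultilinearIn.permute {V : Finset (G × ℕ)} {p : GPoly F G}
    (hp : IsMultilinearIn V p) {σ : Equiv.Perm (G × ℕ)} (hσ : ∀ x, σ x ∈ V ↔ x ∈ V) :
    IsMultilinearIn V (permute σ p) := by
  refine subst_mem_polysOn (Q := multilinearWords V) (fun w hw => ⟨?_, fun x => ?_⟩) hp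
  · have : letters (FreeSemigroup.lift (fun x => FreeSemigroup.of (σ x)) w) =
        (letters w).map σ := by
      rw [letters_lift]
      exact List.map_eq_flatMap.symm
    rw [this]
    exact hw.1.map σ.injective
  · rw [letters_lift, List.mem_flatMap]
    simp only [letters_of, List.mem_singleton]
    constructor
    · rintro ⟨y, hy, rfl⟩
      exact (hσ y).2 ((hw.2 y).1 hy)
    · intro hx
      refine ⟨σ.symm x, (hw.2 _).2 ((hσ _).1 (by simpa using hx)), by simp⟩

theorem swap_mem_iff {V : Finset (G × ℕ)} {x y : G × ℕ} (hx : x ∈ V) (hy : y ∈ V)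
    (z : G × ℕ) : Equiv.swap x y z ∈ V ↔ z ∈ V := by
  rw [Equiv.swap_apply_def]
  split_ifs with h1 h2
  · simp [h1, hx, hy]
  · simp [h2, hx, hy]
  · rfl

/-- Transposing two variables of `S` changes the sign of `p`. -/
def IsSkewIn (S : Finset (G × ℕ)) (p : GPoly F G) : Prop :=
  ∀ x ∈ S, ∀ y ∈ S, x ≠ y → permute (Equiv.swap x y) p = -p

theorem IsSkewIn.sub {S : Finset (G × ℕ)} {p q : GPoly F G} (hp : IsSkewIn S p)
    (hq : IsSkewIn S q) : IsSkewIn S (p - q) := fun x hx y hy hxy => by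
  rw [map_sub, hp x hx y hy hxy, hq x hx y hy hxy]
  abel

theorem IsSkewIn.sum {ι : Type*} {s : Finset ι} {S : Finset (G × ℕ)} {p : ι → GPoly F G}
    (hp : ∀ i ∈ s, IsSkewIn S (p i)) : IsSkewIn S (∑ i ∈ s, p i) := fun x hx y hy hxy => by
  rw [map_sum, ← Finset.sum_neg_distrib]
  exact Finset.sum_congr rfl fun i hi => hp i hi x hx y hy hxy

/-- Substituting for variables outside `S` monomials without variables of `S` preserves
skew symmetry in `S`. -/
theorem IsSkewIn.subst {V S : Finset (G × ℕ)} {p : GPoly F G} (hV : IsMultilinearIn V p)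
    (hp : IsSkewIn S p) {θ : G × ℕ → FreeSemigroup (G × ℕ)}
    (hθ : ∀ x ∈ S, θ x = FreeSemigroup.of x)
    (hθ' : ∀ x ∈ V, x ∉ S → ∀ y ∈ letters (θ x), y ∉ S) : IsSkewIn S (subst θ p) := by
  intro x hx y hy hxy
  rw [← map_neg, ← hp x hx y hy hxy, subst_subst, subst_subst]
  refine subst_congr hV fun z hz => ?_
  rw [FreeSemigroup.lift_of]
  by_cases hzS : z ∈ S
  · rw [hθ z hzS, hθ _ ((swap_mem_iff hx hy z).2 hzS), FreeSemigroup.lift_of]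
  · rw [Equiv.swap_apply_of_ne_of_ne (ne_of_mem_of_not_mem hx hzS).symm
      (ne_of_mem_of_not_mem hy hzS).symm]
    have : ∀ u ∈ letters (θ z), FreeSemigroup.of (Equiv.swap x y u) = FreeSemigroup.of u := by
      intro u hu
      have := hθ' z hz hzS u hu
      rw [Equiv.swap_apply_of_ne_of_ne (ne_of_mem_of_not_mem hx this).symm
        (ne_of_mem_of_not_mem hy this).symm]
    rw [lift_congr this]
    exact congrArg (fun f => f (θ z)) (FreeSemigroup.lift_comp_of' (MulHom.id _))

/-- Transpositions with disjoint supports commute. -/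
theorem IsSkewIn.permute_swap {S : Finset (G × ℕ)} {p : GPoly F G} (hp : IsSkewIn S p)
    {x y : G × ℕ} (hx : x ∉ S) (hy : y ∉ S) : IsSkewIn S (permute (Equiv.swap x y) p) := by
  intro u hu v hv huv
  rw [← map_neg, ← hp u hu v hv huv, permute_permute, permute_permute]
  congr 2
  have h1 : ∀ z ∈ S, Equiv.swap x y z = z := fun z hz =>
    Equiv.swap_apply_of_ne_of_ne (ne_of_mem_of_not_mem hz hx) (ne_of_mem_of_not_mem hz hy)
  rw [Equiv.mul_swap_eq_swap_mul (Equiv.swap x y), h1 u hu, h1 v hv]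

/-- One step of alternation. -/
theorem IsSkewIn.insert {S : Finset (G × ℕ)} {p : GPoly F G} (hp : IsSkewIn S p)
    {s : G × ℕ} (hs : s ∉ S) :
    IsSkewIn (insert s S) (p - ∑ t ∈ S, permute (Equiv.swap s t) p) := by
  -- This rests on `(s t)(s u) = (s u)(u t)` and the skew symmetry of `p` in `u`, `t`. Under `(s
  -- t)`, the terms `p` and `-(s t)p` are exchanged up to sign, and each remaining term changes
  -- sign.
  have key : ∀ t ∈ S, ∀ u ∈ S, t ≠ u →
      permute (Equiv.swap s t) (permute (Equiv.swap s u) p) =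
        -permute (Equiv.swap s u) p := by
    intro t ht u hu htu
    rw [← map_neg, ← hp u hu t ht htu.symm, permute_permute, permute_permute]
    congr 2
    rw [Equiv.mul_swap_eq_swap_mul (Equiv.swap s u) u t, Equiv.swap_apply_right,
      Equiv.swap_apply_of_ne_of_ne (ne_of_mem_of_not_mem ht hs) htu]
  have h1 : ∀ t ∈ S, permute (Equiv.swap s t)
      (p - ∑ t ∈ S, permute (Equiv.swap s t) p) =
        -(p - ∑ t ∈ S, permute (Equiv.swap s t) p) := by
    intro t ht
    rw [map_sub, map_sum, ← Finset.add_sum_erase S _ ht, permute_permute, Equiv.swap_mul_self,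
      permute_one, ← Finset.add_sum_erase S (fun t => permute (Equiv.swap s t) p) ht,
      Finset.sum_congr rfl fun u hu => key t ht u (Finset.mem_of_mem_erase hu)
        (Finset.ne_of_mem_erase hu).symm, Finset.sum_neg_distrib]
    abel
  intro x hx y hy hxy
  rcases Finset.mem_insert.1 hx with rfl | hxS
  · exact h1 y ((Finset.mem_insert.1 hy).resolve_left hxy.symm)
  rcases Finset.mem_insert.1 hy with rfl | hyS
  · rw [Equiv.swap_comm]
    exact h1 x hxS
  rw [map_sub, map_sum, hp x hxS y hyS hxy, neg_sub', sub_right_inj, ← Finset.sum_neg_distrib]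
  refine Finset.sum_bij (fun t _ => Equiv.swap x y t) (fun t ht => (swap_mem_iff hxS hyS t).2 ht)
    (fun _ _ _ _ h => (Equiv.swap x y).injective h)
    (fun t ht => ⟨Equiv.swap x y t, (swap_mem_iff hxS hyS t).2 ht, by simp⟩) fun t ht => ?_
  rw [← map_neg, ← hp x hxS y hyS hxy, permute_permute, permute_permute,
    Equiv.mul_swap_eq_swap_mul (Equiv.swap x y) s t,
    Equiv.swap_apply_of_ne_of_ne (ne_of_mem_of_not_mem hxS hs).symm
      (ne_of_mem_of_not_mem hyS hs).symm]

theorem IsSkewIn.permute_ofSubtype {S : Finset (G × ℕ)} {p : GPoly F G} (hp : IsSkewIn S p)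
    (σ : Equiv.Perm S) :
    permute (Equiv.Perm.ofSubtype σ) p = ((Equiv.Perm.sign σ : ℤˣ) : ℤ) • p := by
  induction σ using Equiv.Perm.swap_induction_on with
  | one => simp [permute_one]
  | swap_mul f x y hxy ih =>
    rw [map_mul, ← permute_permute, ih, map_zsmul, Equiv.Perm.ofSubtype_swap_eq,
      hp x.1 x.2 y.1 y.2 (fun h => hxy (Subtype.ext h)), map_mul, Equiv.Perm.sign_swap hxy]
    simp

end Permutations

/-! ### Skew symmetry is the same as alternation -/

section Alternation

variable {F G : Type*} [Field F]

/-- Alternating a skew symmetric `p` multiplies it by the order of the symmetric group, which is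
invertible here. Thus the induction only has to follow skew symmetry, which is checked on
transpositions. -/
theorem IsSkewIn.alternatesIn [CharZero F] {V S : Finset (G × ℕ)}
    {p : GPoly F G} (hV : IsMultilinearIn V p) (hp : IsSkewIn S p) : AlternatesIn V S p := by
  refine ⟨((Fintype.card (Equiv.Perm S) : F)⁻¹) • p,
    (polysOn F (multilinearWords V)).smul_mem _ hV, ?_⟩
  have h2 : ((Fintype.card (Equiv.Perm S) : F)) ≠ 0 := Nat.cast_ne_zero.2 Fintype.card_ne_zero
  have h3 : p = ∑ σ : Equiv.Perm S, ((Fintype.card (Equiv.Perm S) : F)⁻¹) • p := by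
    rw [Finset.sum_const, Finset.card_univ, ← Nat.cast_smul_eq_nsmul F, smul_smul,
      mul_inv_cancel₀ h2, one_smul]
  refine h3.trans (Finset.sum_congr rfl fun σ _ => ?_)
  rw [map_smul, smul_comm]
  refine congrArg _ ?_
  change p = _ • permute (Equiv.Perm.ofSubtype σ) p
  rw [hp.permute_ofSubtype σ, smul_smul, ← Units.val_mul, Int.units_mul_self]
  simp

/-- Left multiplication by a transposition reindexes the sum over the symmetric group and reverses
all signs. -/
theorem AlternatesIn.isSkewIn {V S : Finset (G × ℕ)} {p : GPoly F G}
    (hp : AlternatesIn V S p) : IsSkewIn S p := by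
  obtain ⟨h, -, hp⟩ := hp
  have hp' : p = ∑ σ : Equiv.Perm S, ((Equiv.Perm.sign σ : ℤˣ) : ℤ) •
      permute (Equiv.Perm.ofSubtype σ) h := hp
  intro x hx y hy hxy
  rw [hp', map_sum, ← Finset.sum_neg_distrib]
  refine Fintype.sum_equiv (Equiv.mulLeft (Equiv.swap ⟨x, hx⟩ ⟨y, hy⟩)) _ _ fun σ => ?_
  rw [map_zsmul, permute_permute, Equiv.coe_mulLeft, map_mul, map_mul,
    Equiv.Perm.sign_swap (fun h => hxy (congrArg Subtype.val h)), Equiv.Perm.ofSubtype_swap_eq]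
  simp

end Alternation

/-! ### Homogeneous components of graded spaces -/

section Gradings

variable {F G A : Type*} [Field F] [NonUnitalRing A] [Module F A] {𝒜 : G → Submodule F A}

theorem IsGradedSubspace.le {U N : Submodule F A} (hU : IsGradedSubspace 𝒜 U)
    (h : ∀ g, U ⊓ 𝒜 g ≤ N) : U ≤ N := by
  rw [hU]
  exact iSup_le h

variable [Group G]

theorem IsGSimple.mul_mem_inf (h𝒜 : IsGrading 𝒜) {B : Submodule F A}
    (hB : IsGSimple 𝒜 B) {k l : G} {a b : A}
    (ha : a ∈ B ⊓ 𝒜 k) (hb : b ∈ B ⊓ 𝒜 l) : a * b ∈ B ⊓ 𝒜 (k * l) :=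
  ⟨hB.mul_mem a ha.1 b hb.1, h𝒜.mul_mem k l a ha.2 b hb.2⟩

theorem IsGrading.isInternal (h𝒜 : IsGrading 𝒜) : DirectSum.IsInternal 𝒜 :=
  DirectSum.isInternal_submodule_of_iSupIndep_of_iSup_eq_top h𝒜.indep h𝒜.iSup_eq_top

/-- The projection onto a homogeneous component. -/
noncomputable def IsGrading.proj (h𝒜 : IsGrading 𝒜) (g : G) : A →ₗ[F] A :=
  letI := h𝒜.isInternal.chooseDecomposition
  (𝒜 g).subtype ∘ₗ DirectSum.component F G (fun g => 𝒜 g) g ∘ₗ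
    (DirectSum.decomposeLinearEquiv 𝒜).toLinearMap

theorem IsGrading.proj_mem (h𝒜 : IsGrading 𝒜) (g : G) (a : A) : h𝒜.proj g a ∈ 𝒜 g :=
  Subtype.mem _

theorem IsGrading.proj_of_mem (h𝒜 : IsGrading 𝒜) {g : G} {a : A} (ha : a ∈ 𝒜 g) :
    h𝒜.proj g a = a :=
  letI := h𝒜.isInternal.chooseDecomposition
  DirectSum.decompose_of_mem_same 𝒜 ha

theorem IsGrading.proj_of_mem_ne (h𝒜 : IsGrading 𝒜) {g k : G} {a : A} (ha : a ∈ 𝒜 k)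
    (hk : k ≠ g) : h𝒜.proj g a = 0 :=
  letI := h𝒜.isInternal.chooseDecomposition
  DirectSum.decompose_of_mem_ne 𝒜 ha hk

theorem IsGrading.isGradedSubspace_top (h𝒜 : IsGrading 𝒜) : IsGradedSubspace 𝒜 ⊤ := by
  simp [IsGradedSubspace, h𝒜.iSup_eq_top]

theorem IsGrading.sum_proj [Fintype G] (h𝒜 : IsGrading 𝒜) (a : A) :
    ∑ g, h𝒜.proj g a = a := by
  have : (⊤ : Submodule F A) ≤ LinearMap.eqLocus (∑ g, h𝒜.proj g) LinearMap.id := by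
    refine h𝒜.isGradedSubspace_top.le fun k x hx => ?_
    rw [LinearMap.mem_eqLocus, LinearMap.sum_apply, Finset.sum_eq_single k, h𝒜.proj_of_mem hx.2]
    · rfl
    · exact fun g _ hg => h𝒜.proj_of_mem_ne hx.2 hg.symm
    · simp
  simpa using this (Submodule.mem_top (x := a))

theorem IsGradedSubspace.proj_mem (h𝒜 : IsGrading 𝒜) {U : Submodule F A}
    (hU : IsGradedSubspace 𝒜 U) {a : A} (ha : a ∈ U) (g : G) : h𝒜.proj g a ∈ U := by
  have : U ≤ U.comap (h𝒜.proj g) := hU.le fun k x hx => by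
    rw [Submodule.mem_comap]
    by_cases hk : k = g
    · subst hk
      rw [h𝒜.proj_of_mem hx.2]
      exact hx.1
    · rw [h𝒜.proj_of_mem_ne hx.2 hk]
      exact U.zero_mem
  exact this ha

end Gradings

/-! ### Graded primeness and density for `G`-simple algebras -/

section GradedSimple

variable {F G A : Type*} [Field F] [Group G] [NonUnitalRing A] [Module F A]
  [IsScalarTower F A A] [SMulCommClass F A A] {𝒜 : G → Submodule F A} {B : Submodule F A}

/-- The sum of the `N h` is a graded ideal of `B`, and its homogeneous components are the `N h`.
This form of simplicity allows ideals to be built degree by degree. -/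
theorem IsGSimple.family (h𝒜 : IsGrading 𝒜) (hB : IsGSimple 𝒜 B) (N : G → Submodule F A)
    (hN : ∀ h, N h ≤ B ⊓ 𝒜 h)
    (hl : ∀ k h, ∀ r ∈ B ⊓ 𝒜 k, ∀ x ∈ N h, r * x ∈ N (k * h))
    (hr : ∀ k h, ∀ r ∈ B ⊓ 𝒜 k, ∀ x ∈ N h, x * r ∈ N (h * k)) :
    (∀ h, N h = ⊥) ∨ ∀ h, N h = B ⊓ 𝒜 h := by
  have hI : IsGradedIdealOf 𝒜 B (⨆ h, N h) := by
    refine ⟨iSup_le fun h => (hN h).trans inf_le_left, ?_, ?_, ?_⟩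
    · refine le_antisymm (iSup_mono fun h => le_inf (le_iSup N h) ((hN h).trans inf_le_right)) ?_
      exact iSup_le fun h => inf_le_left
    · intro b hb a ha
      have h1 : B ≤ (⨆ h, N h).comap (LinearMap.mulRight F a) := by
        refine hB.graded.le fun k r hrk => ?_
        have h2 : ⨆ h, N h ≤ (⨆ h, N h).comap (LinearMap.mulLeft F r) :=
          iSup_le fun h x hx => le_iSup N (k * h) (hl k h r hrk x hx)
        exact h2 ha
      exact h1 hb
    · intro b hb a ha
      have h1 : B ≤ (⨆ h, N h).comap (LinearMap.mulLeft F a) := by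
        refine hB.graded.le fun k r hrk => ?_
        have h2 : ⨆ h, N h ≤ (⨆ h, N h).comap (LinearMap.mulRight F r) :=
          iSup_le fun h x hx => le_iSup N (h * k) (hr k h r hrk x hx)
        exact h2 ha
      exact h1 hb
  rcases hB.eq_bot_or_eq _ hI with h | h
  · exact Or.inl fun k => le_bot_iff.1 (h ▸ le_iSup N k)
  · refine Or.inr fun k => le_antisymm (hN k) fun x hx => ?_
    have h1 : ⨆ h, N h ≤ (N k).comap (h𝒜.proj k) := iSup_le fun j y hy => by
      rw [Submodule.mem_comap]
      by_cases hjk : j = k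
      · subst hjk
        rwa [h𝒜.proj_of_mem (hN _ hy).2]
      · rw [h𝒜.proj_of_mem_ne (hN _ hy).2 hjk]
        exact Submodule.zero_mem _
    have h2 := h1 (h ▸ hx.1 : x ∈ ⨆ h, N h)
    rwa [Submodule.mem_comap, h𝒜.proj_of_mem hx.2] at h2

theorem IsGSimple.exists_homogeneous_mul_ne_zero (hB : IsGSimple 𝒜 B) :
    ∃ k l, ∃ a ∈ B ⊓ 𝒜 k, ∃ b ∈ B ⊓ 𝒜 l, a * b ≠ 0 := by
  by_contra! h
  obtain ⟨a, ha, b, hb, hab⟩ := hB.mul_ne_zero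
  have h1 : B ≤ LinearMap.ker (LinearMap.mulRight F b) := hB.graded.le fun k x hx => by
    have h2 : B ≤ LinearMap.ker (LinearMap.mulLeft F x) := hB.graded.le fun l y hy =>
      h k l x hx y hy
    exact h2 hb
  exact hab (h1 ha)

/-- A `G`-simple algebra is graded prime. -/
theorem IsGSimple.eq_zero_of_sandwich (h𝒜 : IsGrading 𝒜) (hB : IsGSimple 𝒜 B) {g : G} {b : A}
    (hb : b ∈ B ⊓ 𝒜 g) (h : ∀ k l, ∀ r ∈ B ⊓ 𝒜 k, ∀ s ∈ B ⊓ 𝒜 l, r * (b * s) = 0) : b = 0 := by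
  let Z : G → Submodule F A := fun h =>
    { carrier := {x | x ∈ B ⊓ 𝒜 h ∧ ∀ k l, ∀ r ∈ B ⊓ 𝒜 k, ∀ s ∈ B ⊓ 𝒜 l, r * (x * s) = 0}
      add_mem' := fun {x y} hx hy => ⟨add_mem hx.1 hy.1, fun k l r hr s hs => by
        rw [add_mul, mul_add, hx.2 k l r hr s hs, hy.2 k l r hr s hs, add_zero]⟩
      zero_mem' := ⟨zero_mem _, by simp⟩
      smul_mem' := fun c x hx => ⟨Submodule.smul_mem _ c hx.1, fun k l r hr s hs => by
        rw [smul_mul_assoc, mul_smul_comm, hx.2 k l r hr s hs, smul_zero]⟩ }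
  let N : G → Submodule F A := fun h => Submodule.span F
    {x | ∃ k l, k * l = h ∧ ∃ a ∈ B ⊓ 𝒜 k, ∃ b ∈ B ⊓ 𝒜 l, x = a * b}
  obtain ⟨k₀, l₀, a₀, ha₀, b₀, hb₀, hab⟩ := hB.exists_homogeneous_mul_ne_zero
  -- `N` describes the ideal `B²`, which is nonzero, hence all of `B`.
  have hN : ∀ h, N h = B ⊓ 𝒜 h := by
    have hNle : ∀ h, N h ≤ B ⊓ 𝒜 h := fun h => Submodule.span_le.2 <| by
      rintro x ⟨k, l, rfl, a, ha, b, hb, rfl⟩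
      exact hB.mul_mem_inf h𝒜 ha hb
    refine (hB.family h𝒜 N hNle ?_ ?_).resolve_left fun h0 => hab ?_
    · exact fun k h r hr x hx => Submodule.subset_span ⟨k, h, rfl, r, hr, x, hNle h hx, rfl⟩
    · exact fun k h r hr x hx => Submodule.subset_span ⟨h, k, rfl, x, hNle h hx, r, hr, rfl⟩
    · have : a₀ * b₀ ∈ N (k₀ * l₀) :=
        Submodule.subset_span ⟨k₀, l₀, rfl, a₀, ha₀, b₀, hb₀, rfl⟩
      rwa [h0, Submodule.mem_bot] at this
  -- `Z` describes the ideal of those `x` with `B x B = 0`. Were it all of `B`, then `B³ = 0`, which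
  -- together with `B² = B` contradicts `a₀ * b₀ ≠ 0`.
  have hZ : ∀ h, Z h = ⊥ := by
    refine (hB.family h𝒜 Z (fun h x hx => hx.1) ?_ ?_).resolve_right fun h1 => hab ?_
    · refine fun j h t ht x hx => ⟨hB.mul_mem_inf h𝒜 ht hx.1, fun k l r hr s hs => ?_⟩
      have := hx.2 (k * j) l (r * t) (hB.mul_mem_inf h𝒜 hr ht) s hs
      rwa [mul_assoc] at this ⊢
    · refine fun j h t ht x hx => ⟨hB.mul_mem_inf h𝒜 hx.1 ht, fun k l r hr s hs => ?_⟩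
      have := hx.2 k (j * l) r hr (t * s) (hB.mul_mem_inf h𝒜 ht hs)
      rwa [← mul_assoc x] at this
    · have h2 : N k₀ ≤ LinearMap.ker (LinearMap.mulRight F b₀) := Submodule.span_le.2 <| by
        rintro x ⟨k, l, rfl, a, ha, b, hb, rfl⟩
        have h3 : b ∈ Z l := h1 l ▸ hb
        have := h3.2 k l₀ a ha b₀ hb₀
        rwa [← mul_assoc] at this
      exact h2 (hN k₀ ▸ ha₀)
  have : b ∈ Z g := ⟨hb, h⟩
  rwa [hZ, Submodule.mem_bot] at this

/-- The span of the operators `y ↦ r * y * s`, with homogeneous `r` and `s` in `B`, which map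
the elements of degree `g` to elements of degree `h`. -/
def sandwich (𝒜 : G → Submodule F A) (B : Submodule F A) (g h : G) : Submodule F (A →ₗ[F] A) :=
  Submodule.span F {T | ∃ k l, k * g * l = h ∧ ∃ r ∈ B ⊓ 𝒜 k, ∃ s ∈ B ⊓ 𝒜 l,
    T = LinearMap.mulLeft F r ∘ₗ LinearMap.mulRight F s}

theorem IsGSimple.sandwich_apply_mem (h𝒜 : IsGrading 𝒜) (hB : IsGSimple 𝒜 B) {g h : G}
    {T : A →ₗ[F] A} (hT : T ∈ sandwich 𝒜 B g h) {y : A} (hy : y ∈ B ⊓ 𝒜 g) :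
    T y ∈ B ⊓ 𝒜 h := by
  have : sandwich 𝒜 B g h ≤ (B ⊓ 𝒜 h).comap (LinearMap.applyₗ y) := Submodule.span_le.2 <| by
    rintro T ⟨k, l, rfl, r, hr, s, hs, rfl⟩
    have := hB.mul_mem_inf h𝒜 hr (hB.mul_mem_inf h𝒜 hy hs)
    rwa [← mul_assoc] at this
  exact this hT

theorem IsGSimple.mulLeft_comp_mem_sandwich (h𝒜 : IsGrading 𝒜) (hB : IsGSimple 𝒜 B)
    {g h j : G} {T : A →ₗ[F] A} (hT : T ∈ sandwich 𝒜 B g h) {t : A} (ht : t ∈ B ⊓ 𝒜 j) :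
    LinearMap.mulLeft F t ∘ₗ T ∈ sandwich 𝒜 B g (j * h) := by
  induction hT using Submodule.span_induction with
  | mem T hT =>
    obtain ⟨k, l, rfl, r, hr, s, hs, rfl⟩ := hT
    refine Submodule.subset_span ⟨j * k, l, by simp [mul_assoc], t * r,
      hB.mul_mem_inf h𝒜 ht hr, s, hs, ?_⟩
    ext y
    simp
  | zero => simp
  | add S T _ _ hS hT => rw [LinearMap.comp_add]; exact add_mem hS hT
  | smul c T _ hT => rw [LinearMap.comp_smul]; exact Submodule.smul_mem _ c hT

theorem IsGSimple.mulRight_comp_mem_sandwich (h𝒜 : IsGrading 𝒜) (hB : IsGSimple 𝒜 B)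
    {g h j : G} {T : A →ₗ[F] A} (hT : T ∈ sandwich 𝒜 B g h) {t : A} (ht : t ∈ B ⊓ 𝒜 j) :
    LinearMap.mulRight F t ∘ₗ T ∈ sandwich 𝒜 B g (h * j) := by
  induction hT using Submodule.span_induction with
  | mem T hT =>
    obtain ⟨k, l, rfl, r, hr, s, hs, rfl⟩ := hT
    refine Submodule.subset_span ⟨k, l * j, by simp [mul_assoc], r, hr, s * t,
      hB.mul_mem_inf h𝒜 hs ht, ?_⟩
    ext y
    simp [mul_assoc]
  | zero => simp
  | add S T _ _ hS hT => rw [LinearMap.comp_add]; exact add_mem hS hT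
  | smul c T _ hT => rw [LinearMap.comp_smul]; exact Submodule.smul_mem _ c hT

theorem sandwich_apply_eq_zero {g h : G} {T : A →ₗ[F] A} (hT : T ∈ sandwich 𝒜 B g h) {y : A}
    (hy : ∀ s ∈ B, y * s = 0) : T y = 0 := by
  have : sandwich 𝒜 B g h ≤ LinearMap.ker (LinearMap.applyₗ y) := Submodule.span_le.2 <| by
    rintro T ⟨k, l, rfl, r, hr, s, hs, rfl⟩
    simp [hy s hs.1]
  exact this hT

/-- A density theorem for `G`-simple algebras. -/
theorem IsGSimple.exists_sandwich [IsAlgClosed F] [FiniteDimensional F A] (h𝒜 : IsGrading 𝒜)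
    (hB : IsGSimple 𝒜 B) {g : G} (S : Finset A) (hS : ∀ u ∈ S, u ∈ B ⊓ 𝒜 g) :
    ∀ b ∈ B ⊓ 𝒜 g, b ∉ Submodule.span F (S : Set A) → ∀ h, ∀ c ∈ B ⊓ 𝒜 h,
      ∃ T ∈ sandwich 𝒜 B g h, T b = c ∧ ∀ u ∈ S, T u = 0 := by
  -- The images of `b` under the operators killing `S` form a graded ideal, so it is enough that one
  -- such operator does not kill `b`.
  have main : ∀ S : Finset A, ∀ b ∈ B ⊓ 𝒜 g,
      ((∀ k, ∀ T ∈ sandwich 𝒜 B g k, (∀ u ∈ S, T u = 0) → T b = 0) → False) → ∀ h, ∀ c ∈ B ⊓ 𝒜 h,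
      ∃ T ∈ sandwich 𝒜 B g h, T b = c ∧ ∀ u ∈ S, T u = 0 := by
    intro S b hb hne h c hc
    let N : G → Submodule F A := fun h =>
      { carrier := {x | ∃ T ∈ sandwich 𝒜 B g h, T b = x ∧ ∀ u ∈ S, T u = 0}
        add_mem' := by
          rintro _ _ ⟨T, hT, rfl, hT0⟩ ⟨T', hT', rfl, hT0'⟩
          exact ⟨T + T', add_mem hT hT', rfl, fun u hu => by simp [hT0 u hu, hT0' u hu]⟩
        zero_mem' := ⟨0, zero_mem _, rfl, fun _ _ => rfl⟩
        smul_mem' := by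
          rintro c _ ⟨T, hT, rfl, hT0⟩
          exact ⟨c • T, Submodule.smul_mem _ c hT, rfl, fun u hu => by simp [hT0 u hu]⟩ }
    have hN : (∀ h, N h = ⊥) ∨ ∀ h, N h = B ⊓ 𝒜 h := by
      refine hB.family h𝒜 N ?_ ?_ ?_
      · rintro h _ ⟨T, hT, rfl, -⟩
        exact hB.sandwich_apply_mem h𝒜 hT hb
      · rintro k h r hr _ ⟨T, hT, rfl, hT0⟩
        exact ⟨_, hB.mulLeft_comp_mem_sandwich h𝒜 hT hr, rfl, fun u hu => by simp [hT0 u hu]⟩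
      · rintro k h r hr _ ⟨T, hT, rfl, hT0⟩
        exact ⟨_, hB.mulRight_comp_mem_sandwich h𝒜 hT hr, rfl, fun u hu => by simp [hT0 u hu]⟩
    rcases hN with h0 | h1
    · refine (hne fun k T hT hT0 => ?_).elim
      have : T b ∈ N k := ⟨T, hT, rfl, hT0⟩
      rwa [h0, Submodule.mem_bot] at this
    · exact (h1 h ▸ hc : c ∈ N h)
  induction S using Finset.induction_on with
  | empty =>
    intro b hb hb0
    refine main ∅ b hb fun h0 => ?_
    have hb1 : b ≠ 0 := by simpa using hb0
    refine hb1 (hB.eq_zero_of_sandwich h𝒜 hb fun k l r hr s hs => ?_)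
    exact h0 (k * g * l) _ (Submodule.subset_span ⟨k, l, rfl, r, hr, s, hs, rfl⟩) (by simp)
  | insert u S huS ih =>
    intro b hb hbS
    have ih' := ih fun v hv => hS v (Finset.mem_insert_of_mem hv)
    have hu := hS u (Finset.mem_insert_self u S)
    rw [Finset.coe_insert] at hbS
    refine main _ b hb fun h0 => ?_
    have hb0 : b ≠ 0 := fun h => hbS (h ▸ zero_mem _)
    by_cases huS' : u ∈ Submodule.span F (S : Set A)
    · rw [Submodule.span_insert_eq_span huS'] at hbS
      obtain ⟨T, hT, hTb, hT0⟩ := ih' b hb hbS g b hb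
      refine hb0 (hTb ▸ h0 g T hT fun v hv => ?_)
      rcases Finset.mem_insert.1 hv with rfl | hv
      · have : Submodule.span F (S : Set A) ≤ LinearMap.ker T := Submodule.span_le.2 hT0
        exact this huS'
      · exact hT0 v hv
    -- Suppose that every operator killing `S` and `u` kills `b`. Then `T u ↦ T b`, for `T` in `P`,
    -- is a well-defined endomorphism of `B_g`, realised below as `ev b hb ∘ₗ σ`.
    let P : Submodule F (A →ₗ[F] A) :=
      sandwich 𝒜 B g g ⊓ ⨅ v ∈ S, LinearMap.ker (LinearMap.applyₗ v)
    have hP : ∀ T, T ∈ P ↔ T ∈ sandwich 𝒜 B g g ∧ ∀ v ∈ S, T v = 0 := fun T => by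
      simp [P]
    let ev : ∀ y ∈ B ⊓ 𝒜 g, P →ₗ[F] ↥(B ⊓ 𝒜 g) := fun y hy =>
      LinearMap.codRestrict _ (LinearMap.applyₗ y ∘ₗ P.subtype) fun T =>
        hB.sandwich_apply_mem h𝒜 ((hP T).1 T.2).1 hy
    -- The induction hypothesis applies to `b - c • u`, which is independent of `S`.
    have hsurj : ∀ c : F, ∀ w : ↥(B ⊓ 𝒜 g), ∃ T : P, ev b hb T - c • ev u hu T = w := by
      intro c w
      have hmem : b - c • u ∉ Submodule.span F (S : Set A) := fun h => hbS <| by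
        rw [Submodule.mem_span_insert]
        exact ⟨c, b - c • u, h, by abel⟩
      obtain ⟨T, hT, hTw, hT0⟩ := ih' _ (sub_mem hb (Submodule.smul_mem _ c hu)) hmem g w w.2
      refine ⟨⟨T, (hP T).2 ⟨hT, hT0⟩⟩, Subtype.ext ?_⟩
      rw [← hTw, map_sub, map_smul]
      rfl
    have hker : ∀ T : P, ev u hu T = 0 → ev b hb T = 0 := fun T hT => Subtype.ext <|
      h0 g T ((hP T).1 T.2).1 fun v hv => by
        rcases Finset.mem_insert.1 hv with rfl | hv
        · exact congrArg Subtype.val hT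
        · exact ((hP T).1 T.2).2 v hv
    obtain ⟨σ, hσ⟩ := (ev u hu).exists_rightInverse_of_surjective <| LinearMap.range_eq_top.2 <| by
      intro w
      obtain ⟨T, hT, hTw, hT0⟩ := ih' u hu huS' g w w.2
      exact ⟨⟨T, (hP T).2 ⟨hT, hT0⟩⟩, Subtype.ext hTw⟩
    have hσ' : ∀ w, ev u hu (σ w) = w := fun w => LinearMap.congr_fun hσ w
    have : Nontrivial ↥(B ⊓ 𝒜 g) :=
      ⟨⟨⟨b, hb⟩, 0, fun h => hb0 (congrArg Subtype.val h)⟩⟩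
    -- For an eigenvalue `c`, the endomorphism minus `c` is surjective by `hsurj` but not injective,
    -- which is impossible in finite dimension.
    obtain ⟨c, hc⟩ := Module.End.exists_eigenvalue (ev b hb ∘ₗ σ)
    obtain ⟨v, hv⟩ := hc.exists_hasEigenvector
    have hs : Function.Surjective
        (ev b hb ∘ₗ σ - c • LinearMap.id : ↥(B ⊓ 𝒜 g) →ₗ[F] ↥(B ⊓ 𝒜 g)) := fun w => by
      obtain ⟨T, hT⟩ := hsurj c w
      refine ⟨ev u hu T, ?_⟩
      have h1 := hker (σ (ev u hu T) - T) (by rw [map_sub, hσ', sub_self])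
      rw [map_sub, sub_eq_zero] at h1
      rw [← hT, ← h1]
      rfl
    refine hv.2 (LinearMap.injective_iff_surjective.2 hs ?_)
    rw [map_zero, LinearMap.sub_apply, LinearMap.smul_apply, LinearMap.id_apply, hv.apply_eq_smul,
      sub_self]

end GradedSimple

/-! ### A trace criterion for nilpotency -/

section TraceNilpotent

open Polynomial

variable {F M : Type*} [Field F] [CharZero F] [AddCommGroup M] [Module F M]
  [FiniteDimensional F M]

/-- In characteristic zero, an endomorphism is nilpotent if the traces of its powers vanish. -/
theorem isNilpotent_of_trace_pow_eq_zero (T : Module.End F M)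
    (h : ∀ n, LinearMap.trace F M (T ^ (n + 1)) = 0) : IsNilpotent T := by
  have htr : ∀ p : F[X], LinearMap.trace F M (aeval T (X * p)) = 0 := by
    intro p
    induction p using Polynomial.induction_on' with
    | add p q hp hq => rw [mul_add, map_add, map_add, hp, hq, add_zero]
    | monomial n c =>
      rw [← C_mul_X_pow_eq_monomial, mul_left_comm, ← pow_succ', map_mul, aeval_C, map_pow,
        aeval_X, ← Algebra.smul_def, map_smul, h, smul_zero]
  obtain ⟨q, hq, hqX⟩ := exists_eq_pow_rootMultiplicity_mul_and_not_dvd (minpoly F T)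
    (minpoly.ne_zero (Algebra.IsIntegral.isIntegral T)) 0
  set k := (minpoly F T).rootMultiplicity 0
  rw [C_0, sub_zero] at hq hqX
  have hmin : aeval T (X ^ k * q) = 0 := hq ▸ minpoly.aeval F T
  -- The element `e` is the projection onto the part where `T` is invertible. The exponent `k + 1`
  -- instead of `k` provides a factor `X` even if `k = 0`, so `e` has no constant term and its trace
  -- vanishes.
  obtain ⟨u, v, huv⟩ : IsCoprime (X ^ (k + 1)) q :=
    (irreducible_X.coprime_iff_not_dvd.2 hqX).pow_left
  set e := aeval T (u * X ^ (k + 1)) with he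
  have he' : 1 - e = aeval T (v * q) := by
    rw [he, ← map_one (aeval (R := F) T), ← map_sub, ← huv, add_sub_cancel_left]
  have hidem : IsIdempotentElem e := by
    have h0 : e * (1 - e) = 0 := by
      rw [he', he, ← map_mul, show u * X ^ (k + 1) * (v * q) = u * v * X * (X ^ k * q) by ring,
        map_mul, hmin, mul_zero]
    rw [mul_sub, mul_one, sub_eq_zero] at h0
    exact h0.symm
  have he0 : e = 0 := LinearMap.IsIdempotentElem.eq_zero_of_trace_eq_zero hidem <| by
    rw [he, show u * X ^ (k + 1) = X * (u * X ^ k) by ring]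
    exact htr _
  refine ⟨k, ?_⟩
  have h1 : aeval T (X ^ k * (v * q)) = 0 := by
    rw [mul_left_comm, map_mul, hmin, mul_zero]
  rwa [map_mul, ← he', he0, sub_zero, mul_one, map_pow, aeval_X] at h1

end TraceNilpotent

/-! ### The Jacobson radical: nilpotency, trace form, grading -/

theorem list_prod_mem_pow {R : Type*} [Ring R] (I : Ideal R) [I.IsTwoSided] (l : List R) :
    l.prod ∈ I ^ l.countP (· ∈ I) := by
  induction l with
  | nil => simp [Submodule.pow_zero]
  | cons a l ih =>
    rw [List.prod_cons, List.countP_cons]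
    by_cases ha : a ∈ I
    · simp only [ha, decide_true, if_true]
      rcases eq_or_ne (l.countP (· ∈ I)) 0 with h0 | h0
      · rw [h0, zero_add, Submodule.pow_one]
        exact I.mul_mem_right _ ha
      · rw [Submodule.pow_succ' I h0]
        exact Ideal.mul_mem_mul ha ih
    · simpa [ha] using Ideal.mul_mem_left _ a ih

/-- In the unitization, values of monomials become list products, to which powers of the Jacobson
radical apply. -/
theorem inr_lift {F G A : Type*} [Field F] [NonUnitalRing A] [Module F A]
    (φ : G × ℕ → A) (w : FreeSemigroup (G × ℕ)) :
    ((FreeSemigroup.lift φ w : A) : Unitization F A) =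
      ((letters w).map fun x => (φ x : Unitization F A)).prod := by
  induction w using FreeSemigroup.recOnMul with
  | ih1 x => simp [letters_of]
  | ih2 x w _ ih => simp [letters_mul, letters_of, ih]

section Radical

variable {F A : Type*} [Field F] [NonUnitalRing A] [Module F A] [IsScalarTower F A A]
  [SMulCommClass F A A]

theorem mem_radical {a : A} :
    a ∈ radical F A ↔ (a : Unitization F A) ∈ Ring.jacobson (Unitization F A) := Iff.rfl

theorem radical_mul_mem {a : A} (ha : a ∈ radical F A) (b : A) : a * b ∈ radical F A := by
  rw [mem_radical, Unitization.inr_mul]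
  exact Ideal.mul_mem_right _ _ (mem_radical.1 ha)

variable (F A) in
theorem exists_jacobson_pow_eq_bot [FiniteDimensional F A] :
    ∃ n, Ring.jacobson (Unitization F A) ^ n = ⊥ := by
  have : Module.Finite F (Unitization F A) := Module.Finite.equiv (Unitization.linearEquiv F F A).symm
  have : IsArtinianRing (Unitization F A) := IsArtinianRing.of_finite F _
  obtain ⟨n, hn⟩ := IsArtinianRing.isNilpotent_jacobson_bot (R := Unitization F A)
  rw [Ideal.jacobson_bot] at hn
  exact ⟨n, hn⟩

theorem pow_mulLeft (a : A) (n : ℕ) (b : A) :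
    (((LinearMap.mulLeft F a ^ n) b : A) : Unitization F A) = (a : Unitization F A) ^ n * b := by
  induction n with
  | zero => simp
  | succ n ih => rw [pow_succ', Module.End.mul_apply, LinearMap.mulLeft_apply,
      Unitization.inr_mul, ih, pow_succ', mul_assoc]

theorem trace_mulLeft_eq_zero_of_mem_radical [FiniteDimensional F A] {a : A}
    (ha : a ∈ radical F A) : LinearMap.trace F A (LinearMap.mulLeft F a) = 0 := by
  obtain ⟨n, hn⟩ := exists_jacobson_pow_eq_bot F A
  refine (LinearMap.isNilpotent_trace_of_isNilpotent ⟨n, ?_⟩).eq_zero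
  ext b
  apply Unitization.inr_injective (R := F)
  have : (a : Unitization F A) ^ n ∈ Ring.jacobson (Unitization F A) ^ n :=
    Ideal.pow_mem_pow (mem_radical.1 ha) n
  rw [hn, Ideal.mem_bot] at this
  rw [pow_mulLeft, this, zero_mul]
  simp

theorem trace_mulLeft_mul_comm [FiniteDimensional F A] (a b : A) : LinearMap.trace F A (LinearMap.mulLeft F (a * b)) =
    LinearMap.trace F A (LinearMap.mulLeft F (b * a)) := by
  rw [LinearMap.mulLeft_mul, LinearMap.mulLeft_mul]
  exact LinearMap.trace_comp_comm' _ _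

/-- Left multiplication by `a * a` is used instead of `a`, since all its positive powers are
multiplications by some `a * b`, even without an identity. If its `n`-th power is zero, applying
that power to `a` gives `a ^ (2 * n + 1) = 0`. -/
theorem isNilpotent_inr_of_trace [CharZero F] [FiniteDimensional F A] {a : A}
    (h : ∀ b, LinearMap.trace F A (LinearMap.mulLeft F (a * b)) = 0) :
    IsNilpotent (a : Unitization F A) := by
  have key : ∀ n, ∃ b, (LinearMap.mulLeft F (a * a)) ^ (n + 1) = LinearMap.mulLeft F (a * b) := by
    intro n
    induction n with
    | zero => exact ⟨a, by simp⟩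
    | succ n ih =>
      obtain ⟨b, hb⟩ := ih
      refine ⟨a * (a * b), ?_⟩
      rw [pow_succ', hb]
      ext x
      simp
  obtain ⟨n, hn⟩ := isNilpotent_of_trace_pow_eq_zero (LinearMap.mulLeft F (a * a)) fun n => by
    obtain ⟨b, hb⟩ := key n
    rw [hb, h]
  refine ⟨2 * n + 1, ?_⟩
  have := pow_mulLeft (F := F) (a * a) n a
  rw [hn, Unitization.inr_mul, ← sq, ← pow_mul, ← pow_succ] at this
  rw [← this]
  simp

/-- In characteristic zero, the Jacobson radical is the radical of the trace form. -/
theorem mem_radical_iff_trace [CharZero F] [FiniteDimensional F A] {a : A} :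
    a ∈ radical F A ↔ ∀ b, LinearMap.trace F A (LinearMap.mulLeft F (a * b)) = 0 := by
  refine ⟨fun ha b => trace_mulLeft_eq_zero_of_mem_radical (radical_mul_mem ha b), fun ha => ?_⟩
  rw [mem_radical, ← Ideal.jacobson_bot, Ideal.mem_jacobson_iff]
  intro y
  -- `A` is an ideal of its unitization, so the nilpotency criterion applies to every left multiple
  -- of `a`.
  have hy : y * (a : Unitization F A) = ((y.fst • a + y.snd * a : A) : Unitization F A) := by
    ext <;> simp
  have hnil : IsNilpotent ((y.fst • a + y.snd * a : A) : Unitization F A) := by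
    refine isNilpotent_inr_of_trace fun b => ?_
    have h1 : LinearMap.mulLeft F ((y.fst • a + y.snd * a) * b) =
        y.fst • LinearMap.mulLeft F (a * b) + LinearMap.mulLeft F (y.snd * (a * b)) := by
      ext; simp [add_mul, mul_assoc, smul_mul_assoc]
    rw [h1, map_add, map_smul, ha, smul_zero, zero_add, trace_mulLeft_mul_comm, mul_assoc, ha]
  obtain ⟨z, hz⟩ := hnil.isUnit_one_add
  refine ⟨↑z⁻¹, ?_⟩
  rw [mul_assoc, hy, Ideal.mem_bot, sub_eq_zero, ← Units.inv_mul z, hz, mul_add, mul_one,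
    add_comm]

variable {G : Type*} [Group G] {𝒜 : G → Submodule F A}

/-- Left multiplication by `a` moves each component to a different one, so its diagonal blocks are
zero. -/
theorem IsGrading.trace_mulLeft_eq_zero [FiniteDimensional F A] (h𝒜 : IsGrading 𝒜) {g : G}
    (hg : g ≠ 1) {a : A} (ha : a ∈ 𝒜 g) : LinearMap.trace F A (LinearMap.mulLeft F a) = 0 :=
  LinearMap.trace_eq_zero_of_mapsTo_ne h𝒜.isInternal (fun k => g * k) (fun k h => hg (by simpa using h))
    fun k x hx => h𝒜.mul_mem g k a ha x hx

/-- The Jacobson radical is graded. -/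
theorem IsGrading.proj_mem_radical [CharZero F] [FiniteDimensional F A] (h𝒜 : IsGrading 𝒜)
    [Finite G] {a : A} (ha : a ∈ radical F A) (g : G) : h𝒜.proj g a ∈ radical F A := by
  have := Fintype.ofFinite G
  rw [mem_radical_iff_trace] at ha ⊢
  let τ : A →ₗ[F] F := LinearMap.trace F A ∘ₗ LinearMap.mul F A
  have hτ : ∀ x, τ x = LinearMap.trace F A (LinearMap.mulLeft F x) := fun x => rfl
  have key : (⊤ : Submodule F A) ≤ LinearMap.ker (τ ∘ₗ LinearMap.mulLeft F (h𝒜.proj g a)) := by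
    refine h𝒜.isGradedSubspace_top.le fun k b hb => ?_
    rw [LinearMap.mem_ker]
    by_cases hgk : g * k = 1
    · have h1 : τ (a * b) = ∑ j, τ (h𝒜.proj j a * b) := by
        conv_lhs => rw [← h𝒜.sum_proj a, Finset.sum_mul, map_sum]
      rw [Finset.sum_eq_single g, hτ, ha] at h1
      · exact h1.symm
      · intro j _ hj
        refine h𝒜.trace_mulLeft_eq_zero (fun h => hj ?_)
          (h𝒜.mul_mem j k _ (h𝒜.proj_mem j a) b hb.2)
        exact mul_right_cancel (h.trans hgk.symm)
      · simp
    · exact h𝒜.trace_mulLeft_eq_zero hgk (h𝒜.mul_mem g k _ (h𝒜.proj_mem g a) b hb.2)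
  exact fun b => key Submodule.mem_top

/-- The homogeneous components of a complement of the radical have bases consisting of elements
of the `G`-simple components. -/
theorem WedderburnMalcev.exists_basis [CharZero F] [FiniteDimensional F A] [Finite G]
    (h𝒜 : IsGrading 𝒜) (W : WedderburnMalcev 𝒜) (g : G) :
    ∃ S : Finset A, (∀ b ∈ S, ∃ i, b ∈ W.comp i ⊓ 𝒜 g) ∧
      LinearIndepOn F id (S : Set A) ∧ S.card = semisimpleDim 𝒜 g := by
  let X : Set A := {x | ∃ i, x ∈ W.comp i ⊓ 𝒜 g}
  obtain ⟨b, hbX, hspan, hli⟩ := exists_linearIndependent F X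
  have hfin : b.Finite := hli.setFinite
  refine ⟨hfin.toFinset, fun x hx => hbX (by simpa using hx), by rw [hfin.coe_toFinset]; exact hli, ?_⟩
  have h1 : Submodule.span F X ≤ ⨆ i, W.comp i :=
    Submodule.span_le.2 fun x ⟨i, hi⟩ => Submodule.mem_iSup_of_mem i hi.1
  have h2 : 𝒜 g ≤ Submodule.span F X ⊔ radical F A := by
    intro a ha
    obtain ⟨s, hs, j, hj, rfl⟩ := Submodule.mem_sup.1
      (W.isCompl.sup_eq_top ▸ Submodule.mem_top : a ∈ (⨆ i, W.comp i) ⊔ radical F A)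
    rw [← h𝒜.proj_of_mem ha, map_add]
    refine Submodule.add_mem_sup ?_ (h𝒜.proj_mem_radical hj g)
    have : ⨆ i, W.comp i ≤ (Submodule.span F X).comap (h𝒜.proj g) := iSup_le fun i x hx =>
      Submodule.subset_span ⟨i, (W.simple i).graded.proj_mem h𝒜 hx g, h𝒜.proj_mem g x⟩
    exact this hs
  have h3 : (𝒜 g).map (radical F A).mkQ = (Submodule.span F X).map (radical F A).mkQ := by
    refine le_antisymm ((Submodule.map_mono h2).trans ?_) (Submodule.map_mono ?_)
    · rw [Submodule.map_sup, Submodule.mkQ_map_self, sup_bot_eq]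
    · exact Submodule.span_le.2 fun x ⟨i, hi⟩ => hi.2
  have h4 : Function.Injective ((radical F A).mkQ.domRestrict (Submodule.span F X)) := by
    rw [← LinearMap.ker_eq_bot, LinearMap.ker_eq_bot']
    intro x hx
    have hx' : (x : A) ∈ radical F A := (Submodule.Quotient.mk_eq_zero _).1 hx
    exact Subtype.ext ((Submodule.disjoint_def.1 W.isCompl.disjoint) x (h1 x.2) hx')
  rw [semisimpleDim, h3, ← LinearMap.range_domRestrict, LinearMap.finrank_range_of_inj h4,
    ← hspan]
  have h5 : LinearIndepOn F id (hfin.toFinset : Set A) := by rw [hfin.coe_toFinset]; exact hli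
  rw [← finrank_span_finset_eq_card h5, hfin.coe_toFinset]

end Radical

/-! ### Enlarging the alternating sets by one variable -/

section Stages

variable {F G A : Type*} [Field F] [Group G] [NonUnitalRing A] [Module F A]
  [IsScalarTower F A A] [SMulCommClass F A A]

/-- The polynomial `p`, multilinear in `V` and with `evalAt φ p ≠ 0`, is skew symmetric in the
disjoint sets `S e` of variables of degree `deg e`, whose values are listed in `E`, and every
`C i` contains the value of a variable `x i` outside these sets. -/
structure IsStage {ι κ : Type*} [DecidableEq ι] (𝒜 : G → Submodule F A) (C : κ → Submodule F A) (deg : ι → G)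
    (E : Finset (ι × A)) (p : GPoly F G) (V : Finset (G × ℕ)) (S : ι → Finset (G × ℕ))
    (φ : G × ℕ → A) (x : κ → G × ℕ) : Prop where
  multilinear : IsMultilinearIn V p
  admissible : IsAdmissible 𝒜 φ
  eval_ne : evalAt φ p ≠ 0
  slot_mem : ∀ i, x i ∈ V
  slot_val : ∀ i, φ (x i) ∈ C i
  slot_notMem : ∀ i e, x i ∉ S e
  subset : ∀ e, S e ⊆ V
  degree : ∀ e, ∀ t ∈ S e, t.1 = deg e
  disjoint : ∀ e e', e ≠ e' → Disjoint (S e) (S e')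
  skew : ∀ e, IsSkewIn (S e) p
  val : ∀ e, ∀ t ∈ S e, (e, φ t) ∈ E
  card : ∀ e, (S e).card = (E.filter (·.1 = e)).card

/-- The values of the alternating sets of a stage can be extended by an element `b` that is
separated from the other values by operators of `sandwich`. -/
theorem IsStage.insert {ι κ : Type*} [DecidableEq ι] {𝒜 : G → Submodule F A} {C : κ → Submodule F A}
    (hC : Pairwise fun i j => Disjoint (C i) (C j)) {deg : ι → G} {E : Finset (ι × A)}
    {p : GPoly F G} {V : Finset (G × ℕ)} {S : ι → Finset (G × ℕ)} {φ : G × ℕ → A}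
    {x : κ → G × ℕ} (hp : IsStage 𝒜 C deg E p V S φ x) {e : ι} {b : A} (hbE : (e, b) ∉ E)
    {i : κ} (hb : b ∈ 𝒜 (deg e))
    (hsep : ∀ h, ∀ c ∈ C i ⊓ 𝒜 h, ∃ T ∈ sandwich 𝒜 (C i) (deg e) h,
      T b = c ∧ ∀ b', (e, b') ∈ E → T b' = 0) :
    ∃ p' V' S' φ' x', IsStage 𝒜 C deg (insert (e, b) E) p' V' S' φ' x' ∧
      (∀ f, p ∈ tIdealSpan f → p' ∈ tIdealSpan f) ∧ ∀ g, HasDegree p g → HasDegree p' g := by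
  -- A slot shared by two components would take the value `0`, and multilinearity would make `p`
  -- vanish.
  have hxne : ∀ j, j ≠ i → x j ≠ x i := by
    intro j hj h
    refine hp.eval_ne (evalAt_eq_zero_of_apply_eq_zero hp.multilinear (hp.slot_mem i) ?_)
    exact (Submodule.disjoint_def.1 (hC hj)) _ (h ▸ hp.slot_val j) (hp.slot_val i)
  obtain ⟨T, hT, hTb, hT0⟩ := hsep (x i).1 (φ (x i)) ⟨hp.slot_val i, hp.admissible _⟩
  obtain ⟨Λ, hΛ⟩ := exists_linear_evalAt hp.multilinear φ (hp.slot_mem i)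
  choose Λ' hΛ' using fun t => exists_linear_evalAt hp.multilinear (update φ t b) (hp.slot_mem i)
  -- `Ψ U` extends linearly to all operators `U` the value that the new polynomial takes when `U` is
  -- `r · s`. In the term for `t`, the variable `t` has received `b` and the slot contains `U (φ
  -- t)`.
  let Ψ : (A →ₗ[F] A) →ₗ[F] A := Λ ∘ₗ LinearMap.applyₗ b -
    ∑ t ∈ S e, Λ' t ∘ₗ LinearMap.applyₗ (φ t)
  have hΨ : ∀ U : A →ₗ[F] A, Ψ U = Λ (U b) - ∑ t ∈ S e, Λ' t (U (φ t)) := fun U => by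
    simp [Ψ]
  have hΨT : Ψ T ≠ 0 := by
    rw [hΨ, hTb, Finset.sum_eq_zero, sub_zero, hΛ, update_eq_self]
    · exact hp.eval_ne
    · intro t ht
      rw [hT0 _ (hp.val e t ht), map_zero]
  -- A linear map that does not vanish on a span does not vanish on some generator.
  obtain ⟨k, l, hkl, r, hr, s, hs, hne⟩ : ∃ k l, k * deg e * l = (x i).1 ∧
      ∃ r ∈ C i ⊓ 𝒜 k, ∃ s ∈ C i ⊓ 𝒜 l,
        Ψ (LinearMap.mulLeft F r ∘ₗ LinearMap.mulRight F s) ≠ 0 := by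
    by_contra! hcon
    have : sandwich 𝒜 (C i) (deg e) (x i).1 ≤ LinearMap.ker Ψ := Submodule.span_le.2 <| by
      rintro U ⟨k, l, hkl, r, hr, s, hs, rfl⟩
      exact hcon k l hkl r hr s hs
    exact hΨT (this hT)
  obtain ⟨N, hN⟩ : ∃ N, ∀ y ∈ V, y.2 < N :=
    ⟨V.sup Prod.snd + 1, fun y hy => Nat.lt_succ_of_le (Finset.le_sup (f := Prod.snd) hy)⟩
  have hfresh : ∀ (g : G) (n : ℕ), ∀ y ∈ V, y ≠ (g, N + n) := fun g n y hy h => by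
    have := hN y hy
    rw [h] at this
    simp at this
  let y : G × ℕ := (k, N + 0)
  let z : G × ℕ := (deg e, N + 1)
  let w : G × ℕ := (l, N + 2)
  have hyz : y ≠ z := fun h => by simpa [y, z] using congrArg Prod.snd h
  have hyw : y ≠ w := fun h => by simpa [y, w] using congrArg Prod.snd h
  have hzw : z ≠ w := fun h => by simpa [z, w] using congrArg Prod.snd h
  have hVy : ∀ u ∈ V, u ≠ y := hfresh k 0
  have hVz : ∀ u ∈ V, u ≠ z := hfresh (deg e) 1
  have hVw : ∀ u ∈ V, u ≠ w := hfresh l 2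
  have hzS : ∀ e', z ∉ S e' := fun e' h => hVz z (hp.subset e' h) rfl
  let φ' : G × ℕ → A := update (update (update φ y r) z b) w s
  have hφy : φ' y = r := by simp [φ', hyz, hyw]
  have hφz : φ' z = b := by simp [φ', hzw]
  have hφw : φ' w = s := by simp [φ']
  have hφV : ∀ u ∈ V, φ' u = φ u := fun u hu => by simp [φ', hVy u hu, hVz u hu, hVw u hu]
  let θ : G × ℕ → FreeSemigroup (G × ℕ) := update FreeSemigroup.of (x i)
    (FreeSemigroup.of y * (FreeSemigroup.of z * FreeSemigroup.of w))
  have hθi : θ (x i) = FreeSemigroup.of y * (FreeSemigroup.of z * FreeSemigroup.of w) := by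
    simp [θ]
  have hθ : ∀ u, u ≠ x i → θ u = FreeSemigroup.of u := fun u hu => by simp [θ, hu]
  have hθl : letters (θ (x i)) = [y, z, w] := by rw [hθi]; rfl
  have hθdeg : ∀ u, wordDegree (θ u) = u.1 := by
    intro u
    by_cases hu : u = x i
    · subst hu
      rw [hθi, ← hkl, map_mul, map_mul, mul_assoc]
      rfl
    · rw [hθ u hu]
      rfl
  let q : GPoly F G := subst θ p
  let V' : Finset (G × ℕ) := V.biUnion fun u => (letters (θ u)).toFinset
  have hV' : ∀ u, u ∈ V' ↔ (u ∈ V ∧ u ≠ x i) ∨ u = y ∨ u = z ∨ u = w := by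
    intro u
    rw [Finset.mem_biUnion]
    constructor
    · rintro ⟨v, hv, huv⟩
      rw [List.mem_toFinset] at huv
      by_cases hvi : v = x i
      · right
        simpa [hvi, hθl] using huv
      · rw [hθ v hvi, letters_of, List.mem_singleton] at huv
        exact Or.inl (huv ▸ ⟨hv, hvi⟩)
    · rintro (⟨hu, hui⟩ | hu)
      · exact ⟨u, hu, by simp [hθ u hui, letters_of]⟩
      · exact ⟨x i, hp.slot_mem i, by simpa [hθl] using hu⟩
  have hyV' : y ∈ V' := (hV' y).2 (by simp)
  have hzV' : z ∈ V' := (hV' z).2 (by simp)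
  have hSV' : ∀ e', S e' ⊆ V' := fun e' u hu =>
    (hV' u).2 (Or.inl ⟨hp.subset e' hu, ne_of_mem_of_not_mem hu (hp.slot_notMem i e')⟩)
  have hq : IsMultilinearIn V' q := by
    refine hp.multilinear.subst (fun u hu => ?_) fun u hu v hv huv => ?_
    · by_cases hui : u = x i
      · rw [hui, hθl]
        simp [hyz, hyw, hzw]
      · rw [hθ u hui, letters_of]
        exact List.nodup_singleton u
    · by_cases hui : u = x i
      · have hvi : v ≠ x i := fun h => huv (hui.trans h.symm)
        rw [hui, hθl, hθ v hvi, letters_of]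
        simp [hVy v hv, hVz v hv, hVw v hv]
      · by_cases hvi : v = x i
        · rw [hvi, hθl, hθ u hui, letters_of]
          simp [hVy u hu, hVz u hu, hVw u hu]
        · rw [hθ u hui, hθ v hvi, letters_of, letters_of]
          simpa using huv.symm
  have hqskew : ∀ e', IsSkewIn (S e') q := by
    intro e'
    refine (hp.skew e').subst hp.multilinear
      (fun u hu => hθ u (ne_of_mem_of_not_mem hu (hp.slot_notMem i e'))) fun u hu huS v hv hvS => ?_
    by_cases hui : u = x i
    · rw [hui, hθl] at hv
      have hvV := hp.subset e' hvS
      simp [hVy v hvV, hVz v hvV, hVw v hvV] at hv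
    · rw [hθ u hui, letters_of, List.mem_singleton] at hv
      exact huS (hv ▸ hvS)
  let p' : GPoly F G := q - ∑ t ∈ S e, permute (Equiv.swap z t) q
  have hswapS : ∀ e', e' ≠ e → ∀ t ∈ S e, t ∉ S e' := fun e' he t ht ht' =>
    Finset.disjoint_left.1 (hp.disjoint e' e he) ht' ht
  have heval : evalAt φ' p' = Ψ (LinearMap.mulLeft F r ∘ₗ LinearMap.mulRight F s) := by
    have h1 : evalAt φ' q = Λ (r * (b * s)) := by
      rw [hΛ, evalAt_subst]
      refine evalAt_congr hp.multilinear fun u hu => ?_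
      by_cases hui : u = x i
      · rw [hui, hθi, update_self, map_mul, map_mul, FreeSemigroup.lift_of,
          FreeSemigroup.lift_of, FreeSemigroup.lift_of, hφy, hφz, hφw]
      · rw [hθ u hui, update_of_ne hui, FreeSemigroup.lift_of, hφV u hu]
    have h2 : ∀ t ∈ S e, evalAt φ' (permute (Equiv.swap z t) q) = Λ' t (r * (φ t * s)) := by
      intro t ht
      have htV := hp.subset e ht
      rw [hΛ', evalAt_permute, evalAt_subst]
      refine evalAt_congr hp.multilinear fun u hu => ?_
      by_cases hui : u = x i
      · rw [hui, hθi, update_self, map_mul, map_mul, FreeSemigroup.lift_of,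
          FreeSemigroup.lift_of, FreeSemigroup.lift_of, Equiv.swap_apply_left,
          Equiv.swap_apply_of_ne_of_ne hyz (hVy t htV).symm,
          Equiv.swap_apply_of_ne_of_ne hzw.symm (hVw t htV).symm, hφy, hφw, hφV t htV]
      · rw [hθ u hui, update_of_ne hui, FreeSemigroup.lift_of]
        by_cases hut : u = t
        · rw [hut, Equiv.swap_apply_right, update_self, hφz]
        · rw [Equiv.swap_apply_of_ne_of_ne (hVz u hu) hut, update_of_ne hut, hφV u hu]
    rw [map_sub, map_sum, h1, Finset.sum_congr rfl h2, hΨ]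
    rfl
  -- The slot of `C i` is now `y`, whose value `r` lies in `C i`.
  refine ⟨p', V', update S e (Insert.insert z (S e)), φ', update x i y, ?_, ?_, ?_⟩
  · have hS' : ∀ e' u, u ∈ update S e (Insert.insert z (S e)) e' →
        (e' = e ∧ u = z) ∨ u ∈ S e' := by
      intro e' u hu
      by_cases he : e' = e
      · subst he
        rw [update_self, Finset.mem_insert] at hu
        exact hu.imp_left fun h => ⟨rfl, h⟩
      · rw [update_of_ne he] at hu
        exact Or.inr hu
    refine ⟨?_, ?_, heval ▸ hne, ?_, ?_, ?_, ?_, ?_, ?_, ?_, ?_, ?_⟩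
    · refine (polysOn F (multilinearWords V')).sub_mem hq (Submodule.sum_mem _ fun t ht => ?_)
      exact hq.permute (swap_mem_iff hzV' (hSV' e ht))
    · intro u
      by_cases huw : u = w
      · rw [huw, hφw]; exact hs.2
      by_cases huz : u = z
      · rw [huz, hφz]; exact hb
      by_cases huy : u = y
      · rw [huy, hφy]; exact hr.2
      simpa [φ', huw, huz, huy] using hp.admissible u
    · intro j
      by_cases hj : j = i
      · rw [hj, update_self]; exact hyV'
      · rw [update_of_ne hj]
        exact (hV' _).2 (Or.inl ⟨hp.slot_mem j, hxne j hj⟩)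
    · intro j
      by_cases hj : j = i
      · rw [hj, update_self, hφy]; exact hr.1
      · rw [update_of_ne hj, hφV _ (hp.slot_mem j)]
        exact hp.slot_val j
    · intro j e' hmem
      by_cases hj : j = i
      · rw [hj, update_self] at hmem
        rcases hS' e' y hmem with h | h
        · exact hyz h.2
        · exact hVy y (hp.subset e' h) rfl
      · rw [update_of_ne hj] at hmem
        rcases hS' e' _ hmem with h | h
        · exact hVz _ (hp.slot_mem j) h.2
        · exact hp.slot_notMem j e' h
    · intro e' u hu
      rcases hS' e' u hu with h | h
      · exact h.2 ▸ hzV'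
      · exact hSV' e' h
    · intro e' u hu
      rcases hS' e' u hu with ⟨rfl, rfl⟩ | h
      · rfl
      · exact hp.degree e' u h
    · intro e₁ e₂ h12
      rw [Finset.disjoint_left]
      intro u h1 h2
      rcases hS' e₁ u h1 with ⟨h1', rfl⟩ | h1
      · rcases hS' e₂ _ h2 with ⟨h2', -⟩ | h2
        · exact h12 (h1'.trans h2'.symm)
        · exact hzS e₂ h2
      · rcases hS' e₂ _ h2 with ⟨h2', rfl⟩ | h2
        · exact hzS e₁ h1
        · exact Finset.disjoint_left.1 (hp.disjoint e₁ e₂ h12) h1 h2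
    · intro e'
      by_cases he : e' = e
      · subst he
        rw [update_self]
        exact (hqskew e').insert (hzS e')
      · rw [update_of_ne he]
        exact (hqskew e').sub (IsSkewIn.sum fun t ht =>
          (hqskew e').permute_swap (hzS e') (hswapS e' he t ht))
    · intro e' u hu
      rcases hS' e' u hu with ⟨rfl, rfl⟩ | h
      · rw [hφz]; exact Finset.mem_insert_self _ _
      · rw [hφV u (hp.subset e' h)]
        exact Finset.mem_insert_of_mem (hp.val e' u h)
    · intro e'
      by_cases he : e' = e
      · subst he
        rw [update_self, Finset.card_insert_of_notMem (hzS e'), Finset.filter_insert,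
          if_pos rfl, Finset.card_insert_of_notMem (fun h => hbE (Finset.mem_filter.1 h).1),
          hp.card]
      · rw [update_of_ne he, Finset.filter_insert, if_neg (Ne.symm he), hp.card]
  · intro f hf
    have hqf : q ∈ tIdealSpan f := subst_mem_tIdealSpan hf hθdeg
    refine sub_mem hqf (Submodule.sum_mem _ fun t ht => subst_mem_tIdealSpan hqf fun u => ?_)
    change (Equiv.swap z t u).1 = u.1
    rw [Equiv.swap_apply_def]
    have := hp.degree e t ht
    split_ifs with h1 h2
    · rw [this, h1]
    · rw [h2, this]
    · rfl
  · intro g hg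
    have hqg : HasDegree q g := hg.subst hθdeg
    refine (polysOn F {w | wordDegree w = g}).sub_mem hqg
      (Submodule.sum_mem _ fun t ht => hqg.subst fun u => ?_)
    change (Equiv.swap z t u).1 = u.1
    rw [Equiv.swap_apply_def]
    have := hp.degree e t ht
    split_ifs with h1 h2
    · rw [this, h1]
    · rw [h2, this]
    · rfl

end Stages

/-! ### Alternating polynomials for full algebras -/

section Full

variable {F G A : Type*} [Field F] [IsAlgClosed F] [Group G] [NonUnitalRing A] [Module F A]
  [IsScalarTower F A A] [SMulCommClass F A A] [FiniteDimensional F A] {𝒜 : G → Submodule F A}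

/-- Elements of a basis of `⨆ i, W.comp i` are separated by operators of `sandwich`. -/
theorem WedderburnMalcev.exists_sandwich (h𝒜 : IsGrading 𝒜) (W : WedderburnMalcev 𝒜) {g : G}
    {S : Finset A} (hS : ∀ b ∈ S, ∃ i, b ∈ W.comp i ⊓ 𝒜 g) (hli : LinearIndepOn F id (S : Set A))
    {b : A} (hb : b ∈ S) {i : Fin W.q} (hbi : b ∈ W.comp i ⊓ 𝒜 g) (h : G) (c : A)
    (hc : c ∈ W.comp i ⊓ 𝒜 h) : ∃ T ∈ sandwich 𝒜 (W.comp i) g h,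
      T b = c ∧ ∀ b' ∈ S, b' ≠ b → T b' = 0 := by
  have hnot : b ∉ Submodule.span F
      ((S.filter fun b' => b' ∈ W.comp i ∧ b' ≠ b : Finset A) : Set A) := by
    intro hmem
    have hb' := hli.notMem_span hb
    rw [Set.image_id, id] at hb'
    refine hb' (Submodule.span_mono (fun u hu => ?_) hmem)
    rw [Finset.mem_coe, Finset.mem_filter] at hu
    exact ⟨hu.1, hu.2.2⟩
  obtain ⟨T, hT, hTb, hT0⟩ := (W.simple i).exists_sandwich h𝒜
    (S.filter fun b' => b' ∈ W.comp i ∧ b' ≠ b) (fun u hu => by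
      rw [Finset.mem_filter] at hu
      obtain ⟨j, hj⟩ := hS u hu.1
      exact ⟨hu.2.1, hj.2⟩) b hbi hnot h c hc
  refine ⟨T, hT, hTb, fun b' hb' hne => ?_⟩
  by_cases hi : b' ∈ W.comp i
  · exact hT0 b' (Finset.mem_filter.2 ⟨hb', hi, hne⟩)
  · obtain ⟨j, hj⟩ := hS b' hb'
    -- Basis elements from other components are annihilated by the right factor, so density is
    -- needed only inside `W.comp i`.
    refine sandwich_apply_eq_zero hT fun s hs => W.orthogonal j i ?_ b' hj.1 s hs
    rintro rfl
    exact hi hj.1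

theorem IsFullWith.exists_isFoldAlternating [CharZero F] [Finite G] (h𝒜 : IsGrading 𝒜)
    {f : GPoly F G} (hf : IsFullWith 𝒜 f) (ν : ℕ) : ∃ f' ∈ tIdealSpan f, f' ∉ gradedIdentities 𝒜 ∧
      IsFoldAlternating ν (semisimpleDim 𝒜) f' ∧ ∀ g, HasDegree f g → HasDegree f' g := by
  have := Fintype.ofFinite G
  obtain ⟨W, V, φ, hV, hφ, hne, -, hslot⟩ := hf
  choose x hxV hx using hslot
  choose S hS hli hcard using W.exists_basis h𝒜
  -- A pair `((g, j), b)` means that the basis element `b` of degree `g` has been placed in the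
  -- `j`-th set of degree `g`. The induction is on the set of pairs already placed.
  have key : ∀ E : Finset ((G × Fin ν) × A), (∀ u ∈ E, u.2 ∈ S u.1.1) →
      ∃ p' V' S' φ' x', IsStage 𝒜 W.comp Prod.fst E p' V' S' φ' x' ∧ p' ∈ tIdealSpan f ∧
        ∀ g, HasDegree f g → HasDegree p' g := by
    intro E
    induction E using Finset.induction_on with
    | empty =>
      intro _
      refine ⟨f, V, fun _ => ∅, φ, x, ?_, mem_tIdealSpan_self f, fun _ h => h⟩
      exact ⟨hV, hφ, hne, hxV, hx, by simp, by simp, by simp, by simp,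
        fun _ _ h => by simp at h, by simp, by simp⟩
    | insert u E hu ih =>
      intro hE
      obtain ⟨e, b⟩ := u
      obtain ⟨p, V', S', φ', x', hp, hpf, hpd⟩ := ih fun u hu => hE u (Finset.mem_insert_of_mem hu)
      have hbS : b ∈ S e.1 := hE (e, b) (Finset.mem_insert_self _ _)
      obtain ⟨i, hi⟩ := hS e.1 b hbS
      obtain ⟨p', V', S', φ', x', hp', hpf', hpd'⟩ := hp.insert
        (fun i j hij => W.indep.pairwiseDisjoint hij) hu (i := i) hi.2 fun h c hc => by
          obtain ⟨T, hT, hTb, hT0⟩ := W.exists_sandwich h𝒜 (hS e.1) (hli e.1) hbS hi h c hc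
          exact ⟨T, hT, hTb, fun b' hb' => hT0 b' (hE (e, b') (Finset.mem_insert_of_mem hb'))
            fun h => hu (h ▸ hb')⟩
      exact ⟨p', V', S', φ', x', hp', hpf' f hpf, fun g hg => hpd' g (hpd g hg)⟩
  obtain ⟨p, V', S', φ', x', hp, hpf, hpd⟩ := key
    (Finset.univ.biUnion fun e => (S e.1).image (Prod.mk e)) fun u hu => by
      simp only [Finset.mem_biUnion, Finset.mem_univ, true_and, Finset.mem_image] at hu
      obtain ⟨e, b, hb, rfl⟩ := hu
      exact hb
  refine ⟨p, hpf, fun h => hp.eval_ne (h φ' hp.admissible), ?_, hpd⟩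
  refine ⟨V', fun g j => S' (g, j), hp.multilinear, fun g j => ⟨hp.subset _, hp.degree _, ?_⟩,
    fun g j j' hj => hp.disjoint _ _ fun h => hj (congrArg Prod.snd h),
    fun g j => (hp.skew _).alternatesIn hp.multilinear⟩
  rw [hp.card, ← hcard g, ← Finset.card_image_of_injective (S g) (Prod.mk_right_injective (g, j))]
  congr 1
  ext ⟨e, b⟩
  simp only [Finset.mem_filter, Finset.mem_biUnion, Finset.mem_univ, true_and, Finset.mem_image,
    Prod.mk.injEq]
  constructor
  · rintro ⟨⟨e', b', hb', rfl, rfl⟩, rfl⟩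
    exact ⟨b', hb', rfl, rfl⟩
  · rintro ⟨b', hb', rfl, rfl⟩
    exact ⟨⟨_, b', hb', rfl, rfl⟩, rfl⟩

end Full

/-! ### The upper bound and extremal points -/

section Bound

variable {F G A : Type*} [Field F] [NonUnitalRing A] [Module F A] [IsScalarTower F A A]
  [SMulCommClass F A A]

/-- Every monomial contains all the variables of `T`, hence at least `n` factors from the radical.
-/
theorem evalAt_eq_zero_of_radical {n : ℕ} (hn : Ring.jacobson (Unitization F A) ^ n = ⊥)
    {V T : Finset (G × ℕ)} {p : GPoly F G} (hp : IsMultilinearIn V p) (hT : T ⊆ V)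
    (hcard : n ≤ T.card) {φ : G × ℕ → A} (hφ : ∀ x ∈ T, φ x ∈ radical F A) :
    evalAt φ p = 0 := by
  rw [evalAt_eq_sum]
  refine Finset.sum_eq_zero fun w hw => ?_
  suffices h : FreeSemigroup.lift φ w = 0 from
    (congrArg (p.coeff w • ·) h).trans (smul_zero _)
  apply Unitization.inr_injective (R := F)
  rw [inr_lift]
  have hmem := list_prod_mem_pow (Ring.jacobson (Unitization F A))
    ((letters w).map fun x => (φ x : Unitization F A))
  rw [List.countP_map] at hmem
  set m := (letters w).countP _ with hm
  have hle : n ≤ m := by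
    refine hcard.trans ?_
    rw [hm, List.countP_eq_length_filter]
    refine (Finset.card_le_card fun x hx => ?_).trans (List.toFinset_card_le _)
    rw [List.mem_toFinset, List.mem_filter]
    exact ⟨((hp w hw).2 x).2 (hT hx), by simpa using mem_radical.1 (hφ x hx)⟩
  have hbot : Ring.jacobson (Unitization F A) ^ m = ⊥ := by
    rcases hle.eq_or_lt with h | h
    · rw [← h, hn]
    · obtain ⟨r, hr⟩ := Nat.exists_eq_add_of_lt h
      rw [hr, add_assoc, Submodule.pow_add _ r.succ_ne_zero, hn, Submodule.bot_mul]
  rw [hbot, Ideal.mem_bot] at hmem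
  rw [hmem]
  rfl

theorem IsSkewIn.evalAt_eq_zero [CharZero F] {S : Finset (G × ℕ)} {p : GPoly F G}
    (hp : IsSkewIn S p) {x y : G × ℕ} (hx : x ∈ S) (hy : y ∈ S) (hxy : x ≠ y)
    {φ : G × ℕ → A} (h : φ x = φ y) : evalAt φ p = 0 := by
  have h1 := congrArg (evalAt φ) (hp x hx y hy hxy)
  have h2 : (fun z => φ (Equiv.swap x y z)) = φ := by
    funext z
    rw [Equiv.swap_apply_def]
    split_ifs with h1 h2
    · rw [h1, h]
    · rw [h2, h]
    · rfl
  rw [evalAt_permute, h2, map_neg] at h1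
  have h3 : (2 : F) • evalAt φ p = 0 := by
    rw [two_smul]
    nth_rw 1 [h1]
    exact neg_add_cancel _
  exact (smul_eq_zero.1 h3).resolve_left two_ne_zero

/-- The images of the values lie in a space of dimension `semisimpleDim 𝒜 g`, too small for them to
be independent. -/
theorem exists_dependent_mod_radical [FiniteDimensional F A] {𝒜 : G → Submodule F A}
    {S : Finset (G × ℕ)} {g : G} {φ : G × ℕ → A}
    (hφ : ∀ x ∈ S, φ x ∈ 𝒜 g) (hcard : semisimpleDim 𝒜 g < S.card) :
    ∃ x ∈ S, ∃ r ∈ radical F A, φ x - r ∈ Submodule.span F (φ '' {y | y ∈ S ∧ y ≠ x}) := by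
  let v : S → A ⧸ radical F A := fun x => (radical F A).mkQ (φ x)
  have hli : ¬ LinearIndependent F v := by
    intro hli
    have h1 := finrank_span_eq_card hli
    have h2 : Submodule.span F (Set.range v) ≤ (𝒜 g).map (radical F A).mkQ :=
      Submodule.span_le.2 <| by
        rintro _ ⟨x, rfl⟩
        exact ⟨φ x, hφ x x.2, rfl⟩
    have h3 := Submodule.finrank_mono h2
    rw [h1, Fintype.card_coe] at h3
    exact absurd hcard (not_lt.2 h3)
  rw [linearIndependent_iff_notMem_span] at hli
  push Not at hli
  obtain ⟨x, hx⟩ := hli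
  have h1 : v '' (Set.univ \ {x}) ⊆ (radical F A).mkQ '' (φ '' {y | y ∈ S ∧ y ≠ x}) := by
    rintro _ ⟨y, hy, rfl⟩
    exact ⟨φ y, ⟨y, ⟨y.2, fun h => hy.2 (Subtype.ext h)⟩, rfl⟩, rfl⟩
  have h2 := Submodule.span_mono h1 hx
  rw [Submodule.span_image] at h2
  obtain ⟨u, hu, hux⟩ := h2
  refine ⟨x, x.2, φ x - u, ?_, by rwa [sub_sub_cancel]⟩
  rw [← Submodule.ker_mkQ (radical F A), LinearMap.mem_ker, map_sub, hux, sub_self]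

/-- If `A` is full with respect to a polynomial, then it is full with respect to one of its
homogeneous components. -/
theorem IsFullWith.exists_hasDegree [Group G] [Finite G] {𝒜 : G → Submodule F A}
    {f : GPoly F G} (hf : IsFullWith 𝒜 f) :
    ∃ f' g, IsFullWith 𝒜 f' ∧ HasDegree f' g := by
  have := Fintype.ofFinite G
  obtain ⟨W, V, φ, hV, hφ, hne, h1, h2⟩ := hf
  let c : G → GPoly F G := fun g => .ofCoeff (f.coeff.filter fun w => wordDegree w = g)
  have hsum : f = ∑ g, c g := by
    apply MonoidAlgebra.coeff_injective
    ext w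
    rw [MonoidAlgebra.coeff_sum, Finsupp.finsetSum_apply,
      Finset.sum_eq_single (wordDegree w)]
    · exact (Finsupp.filter_apply_pos (fun v => wordDegree v = wordDegree w) f.coeff rfl).symm
    · exact fun g _ hg => Finsupp.filter_apply_neg (fun v => wordDegree v = g) f.coeff hg.symm
    · simp
  obtain ⟨g, hg⟩ : ∃ g, evalAt φ (c g) ≠ 0 := by
    by_contra! hcon
    rw [hsum, map_sum] at hne
    exact hne (Finset.sum_eq_zero fun g _ => hcon g)
  have hsupp : ∀ w ∈ (c g).coeff.support, w ∈ f.coeff.support ∧ wordDegree w = g := by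
    intro w hw
    have : w ∈ (f.coeff.filter fun w => wordDegree w = g).support := hw
    rwa [Finsupp.support_filter, Finset.mem_filter] at this
  exact ⟨c g, g, ⟨W, V, φ, fun w hw => hV w (hsupp w hw).1, hφ, hg, h1, h2⟩,
    fun w hw => (hsupp w hw).2⟩

variable [Group G] [CharZero F] [FiniteDimensional F A] {𝒜 : G → Submodule F A}

theorem le_semisimpleDim_of_mem_Ind₀ {α : G → ℕ}
    (hα : α ∈ Ind₀ (gradedIdentities 𝒜)) : α ≤ semisimpleDim 𝒜 := by
  by_contra hle
  rw [Pi.le_def] at hle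
  push Not at hle
  obtain ⟨g, hg⟩ := hle
  obtain ⟨n, hn⟩ := exists_jacobson_pow_eq_bot F A
  -- The number of alternating sets is an exponent `n` that annihilates the radical.
  obtain ⟨p, hp, -, V, S, hV, hS, hdisj, halt⟩ := hα n
  refine hp fun φ hφ => ?_
  have hskew : ∀ j, IsSkewIn (S g j) p := fun j => (halt g j).isSkewIn
  choose x hxS r hr hspan using fun j => exists_dependent_mod_radical (𝒜 := 𝒜) (S := S g j)
    (φ := φ) (fun y hy => (hS g j).2.1 y hy ▸ hφ y) ((hS g j).2.2 ▸ hg)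
  have hne : ∀ j j', j ≠ j' → ∀ y ∈ S g j, y ≠ x j' := fun j j' h y hy h' =>
    Finset.disjoint_left.1 (hdisj g j j' h) hy (h' ▸ hxS j')
  -- The value of `x j` can be replaced by its radical part `r j` in one set after another without
  -- changing the value of `p`; the sets are disjoint, so the replacements do not interfere.
  have key : ∀ T : Finset (Fin n), ∃ ψ : G × ℕ → A, (∀ j ∈ T, ψ (x j) ∈ radical F A) ∧
      (∀ y, (∀ j ∈ T, y ≠ x j) → ψ y = φ y) ∧ evalAt ψ p = evalAt φ p := by
    intro T
    induction T using Finset.induction_on with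
    | empty => exact ⟨φ, by simp, by simp, rfl⟩
    | insert j T hj ih =>
      obtain ⟨ψ, hψr, hψ, heq⟩ := ih
      have hψS : ∀ y ∈ S g j, ψ y = φ y := fun y hy => hψ y fun j' hj' =>
        hne j j' (fun h => hj (h ▸ hj')) y hy
      refine ⟨update ψ (x j) (r j), ?_, ?_, ?_⟩
      · intro j' hj'
        by_cases hjj : j' = j
        · rw [hjj, update_self]
          exact hr j
        · rw [update_of_ne (hne j' j hjj _ (hxS j'))]
          exact hψr j' ((Finset.mem_insert.1 hj').resolve_left hjj)
      · intro y hy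
        rw [update_of_ne (hy j (Finset.mem_insert_self j T))]
        exact hψ y fun j' hj' => hy j' (Finset.mem_insert_of_mem hj')
      · obtain ⟨Λ, hΛ⟩ := exists_linear_evalAt hV ψ ((hS g j).1 (hxS j))
        -- Giving `x j` the value of another variable of its alternating set makes `p` vanish by
        -- skew symmetry.
        have h0 : Submodule.span F (φ '' {y | y ∈ S g j ∧ y ≠ x j}) ≤ LinearMap.ker Λ :=
          Submodule.span_le.2 <| by
            rintro _ ⟨y, ⟨hy, hyx⟩, rfl⟩
            rw [SetLike.mem_coe, LinearMap.mem_ker, hΛ]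
            refine (hskew j).evalAt_eq_zero (hxS j) hy hyx.symm ?_
            rw [update_self, update_of_ne hyx, hψS y hy]
        have h1 : Λ (φ (x j) - r j) = 0 := h0 (hspan j)
        rw [map_sub, sub_eq_zero, ← hψS _ (hxS j), hΛ, hΛ, update_eq_self] at h1
        rw [← h1, heq]
  obtain ⟨ψ, hψr, -, heq⟩ := key Finset.univ
  have hxinj : Function.Injective x := fun j j' h => by
    by_contra hjj
    exact hne j j' hjj _ (hxS j) h
  rw [← heq]
  refine evalAt_eq_zero_of_radical hn hV (T := Finset.univ.image x) ?_ ?_ ?_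
  · intro y hy
    obtain ⟨j, -, rfl⟩ := Finset.mem_image.1 hy
    exact (hS g j).1 (hxS j)
  · rw [Finset.card_image_of_injective _ hxinj, Finset.card_univ, Fintype.card_fin]
  · intro y hy
    obtain ⟨j, -, rfl⟩ := Finset.mem_image.1 hy
    exact hψr j (Finset.mem_univ j)

theorem IsFull.semisimpleDim_mem_Ind₀ [IsAlgClosed F] [Finite G] (h𝒜 : IsGrading 𝒜)
    (hA : IsFull 𝒜) : semisimpleDim 𝒜 ∈ Ind₀ (gradedIdentities 𝒜) := by
  obtain ⟨f, hf⟩ := hA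
  obtain ⟨f', g, hf', hg⟩ := hf.exists_hasDegree
  intro ν
  obtain ⟨p, -, hp, hpalt, hpdeg⟩ := hf'.exists_isFoldAlternating h𝒜 ν
  exact ⟨p, hp, ⟨g, hpdeg g hg⟩, hpalt⟩

end Bound

end GradedPI

theorem mainTheorem10 {F G A : Type*} [Field F] [CharZero F] [IsAlgClosed F]
    [Group G] [Finite G]
    [NonUnitalRing A] [Module F A] [IsScalarTower F A A] [SMulCommClass F A A]
    [FiniteDimensional F A]
    (𝒜 : G → Submodule F A) (h𝒜 : GradedPI.IsGrading 𝒜)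
    (hA : GradedPI.IsSubdirectlyIrreducible 𝒜) :
    (∀ f : GradedPI.GPoly F G, GradedPI.IsFullWith 𝒜 f → ∀ ν : ℕ,
      ∃ f' ∈ GradedPI.tIdealSpan f, f' ∉ GradedPI.gradedIdentities 𝒜 ∧
        GradedPI.IsFoldAlternating ν (GradedPI.semisimpleDim 𝒜) f' ∧
        (GradedPI.IsStronglyHomogeneous f → GradedPI.IsStronglyHomogeneous f')) ∧
    (GradedPI.IsFull 𝒜 →
      GradedPI.E₀ (GradedPI.gradedIdentities 𝒜) = {GradedPI.semisimpleDim 𝒜}) := by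
  refine ⟨fun f hf ν => ?_, fun hfull => ?_⟩
  · obtain ⟨f', hmem, hne, halt, hdeg⟩ := hf.exists_isFoldAlternating h𝒜 ν
    exact ⟨f', hmem, hne, halt, fun ⟨g, hg⟩ => ⟨g, hdeg g hg⟩⟩
  · have hd := hfull.semisimpleDim_mem_Ind₀ h𝒜
    ext α
    rw [Set.mem_singleton_iff]
    constructor
    · rintro ⟨hα, hmax⟩
      -- The point `(d_g)` belongs to `Ind₀` and dominates it, so a maximal element must coincide
      -- with it.
      exact (hmax _ hd (GradedPI.le_semisimpleDim_of_mem_Ind₀ hα)).symm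
    · rintro rfl
      exact ⟨hd, fun β hβ hle => le_antisymm (GradedPI.le_semisimpleDim_of_mem_Ind₀ hβ) hle⟩
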